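/- For a group $E$ and a field $F$, an $E$-extension of $F$ is a Galois extension $L/F$, inside a fixed algebraic closure $\bar F$ of $F$, with $\mathrm{Gal}(L/F)\simeq E$. Let $\nu(E,F)$ be the number (possibly infinite) of distinct $E$-extensions of $F$ inside $\bar F$, and let the realization multiplicity of $E$ be $\nu(E)=\min\{\nu(E,F) : F \text{ a field with } \nu(E,F)\ge 1\}$. Let $p$ be a prime, let $n\ge 1$ be an integer, with $n\ge 2$ when $p=2$, and let $k\ge 0$ be an integer. Write $G=\mathbb{Z}/p^n\mathbb{Z}$ and let $\mathbb{F}_p[G]^k\rtimes G$ be the semidirect product in which $G$ acts on each copy of the group ring $\mathbb{F}_p[G]$ by multiplication by group elements. Then $$\nu\left(\mathbb{F}_p[G]^k\rtimes G\right)\ \ge\ p^k .$$ Moreover, let $F$ be any field, $K\subseteq\bar F$ a Galois extension of $F$ and $\varphi:\mathrm{Gal}(K/F)\to G$ an isomorphism. Call a Galois extension $L/F$ with $K\subseteq L\subseteq\bar F$ a solution of the embedding problem $\mathbb{F}_p[G]^k\rtimes G\to G\simeq\mathrm{Gal}(K/F)$ if there is an isomorphism $\psi:\mathrm{Gal}(L/F)\to\mathbb{F}_p[G]^k\rtimes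 G$ such that $\pi\circ\psi=\varphi\circ\mathrm{res}_{L/K}$, where $\pi:\mathbb{F}_p[G]^k\rtimes G\to G$ is the canonical projection and $\mathrm{res}_{L/K}:\mathrm{Gal}(L/F)\to\mathrm{Gal}(K/F)$ is restriction. If this embedding problem has at least one solution, then it has at least $p^k$ distinct solutions $L$. -/

import Mathlib

universe u

/-- `L` is a `G`-extension of `F`: an extension of `F` inside the fixed algebraic closure of `F`
which is Galois over `F` with Galois group isomorphic to `G`. -/
def IsGExtension (G : Type*) [Group G] (F : Type*) [Field F]
    (L : IntermediateField F (AlgebraicClosure F)) : Prop :=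
  IsGalois F L ∧ Nonempty (Gal(L/F) ≃* G)

/-- `ν(G, F)`: the number (possibly infinite) of distinct `G`-extensions of `F` inside the fixed
algebraic closure of `F`. -/
noncomputable def extensionCount (G : Type*) [Group G] (F : Type*) [Field F] : ℕ∞ :=
  Set.encard {L : IntermediateField F (AlgebraicClosure F) | IsGExtension G F L}

/-- `F` belongs to the class `𝔉(G)` of fields with at least one `G`-extension. -/
def Realizes (G : Type*) [Group G] (F : Type*) [Field F] : Prop :=
  1 ≤ extensionCount G F

/-- The realization multiplicity `ν(G)`: the minimum of `ν(G, F)` over all fields `F` having at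
least one `G`-extension. For a finite group the set below is nonempty (see
`exists_realizes`), so that the infimum in the well-ordered set `ℕ∞` is a minimum. -/
noncomputable def realizationMultiplicity.{w, v} (G : Type v) [Group G] : ℕ∞ :=
  sInf {m : ℕ∞ | ∃ (F : Type w) (_ : Field F), Realizes G F ∧ m = extensionCount G F}

/-- Every finite group is a Galois group over some field, in every universe. -/
theorem exists_realizes.{w, v} (G : Type v) [Group G] [Finite G] :
    ∃ (F : Type w) (_ : Field F), Realizes G F := by
  classical
  -- a copy of `G` in the right universe, and the permutations of variables of `ℚ(x_g : g ∈ G)`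
  obtain ⟨m, ⟨e⟩⟩ := Finite.exists_equiv_fin G
  let ι : Type w := ULift.{w} (Fin m)
  let e' : G ≃ ι := e.trans Equiv.ulift.symm
  let A := MvPolynomial ι ℚ
  let L := FractionRing A
  let f₀ : G →* Equiv.Perm ι := e'.permCongrHom.toMonoidHom.comp (MulAction.toPermHom G G)
  have hf₀ : Function.Injective f₀ :=
    e'.permCongrHom.injective.comp MulAction.toPerm_injective
  let f₁ : Equiv.Perm ι →* (A ≃+* A) :=
    { toFun := fun s => (MvPolynomial.renameEquiv ℚ s).toRingEquiv
      map_one' := by ext x; simp [A]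
      map_mul' := fun s t => by
        apply RingEquiv.ext
        intro x
        simp [A, MvPolynomial.rename_rename] }
  have hf₁ : Function.Injective f₁ := by
    intro s t h
    ext i : 1
    have := congrArg (fun r : A ≃+* A => r (MvPolynomial.X i)) h
    change (MvPolynomial.rename s) (MvPolynomial.X i : A) =
      (MvPolynomial.rename t) (MvPolynomial.X i : A) at this
    rw [MvPolynomial.rename_X, MvPolynomial.rename_X] at this
    exact MvPolynomial.X_injective this
  let f₂ : (A ≃+* A) →* (L ≃+* L) := IsFractionRing.ringEquivOfRingEquivHom A L
  have hf₂ : Function.Injective f₂ := by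
    intro s t h
    apply RingEquiv.ext
    intro b
    have := congrArg (fun r : L ≃+* L => r (algebraMap A L b)) h
    exact IsFractionRing.injective A L (by simpa [f₂] using this)
  let : MulSemiringAction G L := MulSemiringAction.compHom L (f₂.comp (f₁.comp f₀))
  have : FaithfulSMul G L := ⟨fun {g h} H =>
    hf₀ (hf₁ (hf₂ (RingEquiv.ext H)))⟩
  let F := FixedPoints.subfield G L
  have : IsGalois F L := IsGaloisGroup.isGalois G F L
  let j : L →ₐ[F] AlgebraicClosure F := IsAlgClosed.lift
  let j' : L ≃ₐ[F] j.fieldRange := AlgEquiv.ofInjectiveField j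
  refine ⟨F, inferInstance, ?_⟩
  have hmem : j.fieldRange ∈
      {M : IntermediateField F (AlgebraicClosure F) | IsGExtension G F M} :=
    ⟨IsGalois.of_algEquiv j',
      ⟨(AlgEquiv.autCongr j').symm.trans (FixedPoints.toAlgAutMulEquiv G L).symm⟩⟩
  exact Set.one_le_encard_iff_nonempty.2 ⟨_, hmem⟩

/-- The action of `G` on the free module `R[G]^k`, where `g` acts on each coordinate as
multiplication by the group element `g ∈ R[G]`; the additive group `R[G]^k` is written
multiplicatively. -/
noncomputable def freeModuleAction (R G : Type*) [Ring R] [Group G] (k : ℕ) :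
    G →* MulAut (Multiplicative (Fin k → MonoidAlgebra R G)) where
  toFun g :=
    { toFun := fun v => Multiplicative.ofAdd fun i => MonoidAlgebra.of R G g * v.toAdd i
      invFun := fun v => Multiplicative.ofAdd fun i => MonoidAlgebra.of R G g⁻¹ * v.toAdd i
      left_inv := fun v => by
        apply Multiplicative.toAdd.injective
        funext i
        simp only [toAdd_ofAdd]
        rw [← mul_assoc, ← map_mul, inv_mul_cancel, map_one, one_mul]
      right_inv := fun v => by
        apply Multiplicative.toAdd.injective
        funext i
        simp only [toAdd_ofAdd]
        rw [← mul_assoc, ← map_mul, mul_inv_cancel, map_one, one_mul]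
      map_mul' := fun v w => by
        apply Multiplicative.toAdd.injective
        funext i
        simp only [toAdd_mul, toAdd_ofAdd, Pi.add_apply, mul_add] }
  map_one' := by
    apply MulEquiv.ext
    intro v
    apply Multiplicative.toAdd.injective
    funext i
    exact (congrArg (· * v.toAdd i) (map_one (MonoidAlgebra.of R G))).trans (one_mul _)
  map_mul' g h := by
    apply MulEquiv.ext
    intro v
    apply Multiplicative.toAdd.injective
    funext i
    exact (congrArg (· * v.toAdd i) (map_mul (MonoidAlgebra.of R G) g h)).trans
      (mul_assoc _ _ _)

/-- The semidirect product `R[G]^k ⋊ G`. -/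
abbrev FreeModuleSemidirect (R G : Type*) [Ring R] [Group G] (k : ℕ) : Type _ :=
  Multiplicative (Fin k → MonoidAlgebra R G) ⋊[freeModuleAction R G k] G

/-- The cyclic group `ℤ/p^nℤ`, written multiplicatively. -/
abbrev CyclicPPow (p n : ℕ) : Type := Multiplicative (ZMod (p ^ n))

/-- `L/F` is a (proper) solution of the embedding problem `π : E → G` over the `G`-extension `K/F`
with identification `φ : Gal(K/F) ≃ G`: the field `L` contains `K`, is Galois over `F`, and there
is an isomorphism `ψ : Gal(L/F) ≃ E` for which the restriction `Gal(L/F) → Gal(K/F)` corresponds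
to `π`, that is, each `τ ∈ Gal(L/F)` acts on `K` as `φ⁻¹(π(ψ(τ)))`. -/
def SolvesEmbeddingProblem {E G : Type*} [Group E] [Group G] (π : E →* G)
    {F : Type*} [Field F] (K : IntermediateField F (AlgebraicClosure F)) (φ : Gal(K/F) ≃* G)
    (L : IntermediateField F (AlgebraicClosure F)) : Prop :=
  IsGalois F L ∧ ∃ hKL : K ≤ L, ∃ ψ : Gal(L/F) ≃* E, ∀ (τ : Gal(L/F)) (x : K),
    τ (IntermediateField.inclusion hKL x) =
      IntermediateField.inclusion hKL (φ.symm (π (ψ τ)) x)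

/-!
A surjection `Ψ` from the absolute Galois group onto `𝔽_p[G]^k ⋊ G` can be twisted by 1-cocycles
with values in `𝔽_p[G]^k`. By Shapiro's lemma these come from characters of the kernel `N` of the
projection to `G`: a character `u` and `c ∈ 𝔽_p^k` give the twist by `c ⊗ u`. If the norm of `u`
under `G` is zero, the twist changes `Ψ` on `N` only by elements of the commutator subgroup, so it
remains surjective because the target is nilpotent. If moreover `u` does not vanish on `ker Ψ`, the
`p^k` twists have distinct kernels.

If every character of norm zero vanished on `ker Ψ`, then all characters of `N` would, so that
`H¹(N, 𝔽_p)` would be the dual of the free module `𝔽_p[G]^k`; for `s ∈ G` of order `p`, each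
`s`-invariant character of `N` would then be a norm from `⟨s⟩`. Hilbert 90 together with
Artin–Schreier theory in characteristic `p`, and Kummer theory otherwise, yields an `s`-invariant
character that is not a norm.
-/

universe v

open Finset

section Characters

variable {p : ℕ} {Γ : Type*} [Group Γ] [TopologicalSpace Γ]

/-- The group `H¹(Γ, 𝔽_p)` of continuous additive characters of `Γ` with values in `𝔽_p`. -/
def modCharacters (p : ℕ) (Γ : Type*) [Group Γ] [TopologicalSpace Γ] :
    Submodule (ZMod p) (Γ → ZMod p) where
  carrier := {u | (∀ g h, u (g * h) = u g + u h) ∧ Continuous u}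
  zero_mem' := ⟨fun _ _ => (add_zero 0).symm, continuous_const⟩
  add_mem' := fun ⟨hu, hu'⟩ ⟨hv, hv'⟩ =>
    ⟨fun g h => by simp only [Pi.add_apply, hu, hv, add_add_add_comm], hu'.add hv'⟩
  smul_mem' := fun c _ ⟨hu, hu'⟩ =>
    ⟨fun g h => by simp only [Pi.smul_apply, hu, smul_add], hu'.const_smul c⟩

namespace modCharacters

/-- A character as a homomorphism into the multiplicative copy of `𝔽_p`. -/
def toHom (u : modCharacters p Γ) : Γ →* Multiplicative (ZMod p) :=
  MonoidHom.mk' (fun g => Multiplicative.ofAdd (u.1 g)) fun g h =>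
    congrArg Multiplicative.ofAdd (u.2.1 g h)

protected theorem map_mul (u : modCharacters p Γ) (g h : Γ) : u.1 (g * h) = u.1 g + u.1 h :=
  u.2.1 g h

protected theorem map_one (u : modCharacters p Γ) : u.1 1 = 0 :=
  congrArg Multiplicative.toAdd (map_one (toHom u))

protected theorem map_inv (u : modCharacters p Γ) (g : Γ) : u.1 g⁻¹ = -u.1 g :=
  congrArg Multiplicative.toAdd (map_inv (toHom u) g)

protected theorem map_pow (u : modCharacters p Γ) (g : Γ) (n : ℕ) : u.1 (g ^ n) = n * u.1 g :=
  (congrArg Multiplicative.toAdd (map_pow (toHom u) g n)).trans (nsmul_eq_mul _ _)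

theorem isOpen_ker (u : modCharacters p Γ) : IsOpen ((toHom u).ker : Set Γ) :=
  (isOpen_discrete {(0 : ZMod p)}).preimage u.2.2

/-- A homomorphism with open kernel as a character. -/
def ofHom [IsTopologicalGroup Γ] (f : Γ →* Multiplicative (ZMod p))
    (hf : IsOpen (f.ker : Set Γ)) : modCharacters p Γ :=
  ⟨fun g => (f g).toAdd, fun g h => congrArg Multiplicative.toAdd (map_mul f g h),
    continuous_toAdd.comp (continuous_of_continuousAt_one f
      (continuousAt_const.congr (Filter.mem_of_superset (hf.mem_nhds f.ker.one_mem) fun g hg => by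
        simpa using (MonoidHom.mem_ker.1 hg).symm)))⟩

/-- The pullback `H¹(Γ, 𝔽_p) → H¹(Γ', 𝔽_p)` along a continuous homomorphism `Γ' → Γ`. -/
def comap {Γ' : Type*} [Group Γ'] [TopologicalSpace Γ'] (f : Γ' →* Γ) (hf : Continuous f) :
    modCharacters p Γ →ₗ[ZMod p] modCharacters p Γ' :=
  (LinearMap.funLeft (ZMod p) (ZMod p) f).restrict fun u hu =>
    ⟨fun g h => by simp only [LinearMap.funLeft_apply, map_mul, hu.1], hu.2.comp hf⟩

/-- Restriction `H¹(X, 𝔽_p) → H¹(Y, 𝔽_p)` of characters to a subgroup. -/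
def restrict {X Y : Subgroup Γ} (h : Y ≤ X) : modCharacters p X →ₗ[ZMod p] modCharacters p Y :=
  comap (Subgroup.inclusion h) (continuous_inclusion h)

end modCharacters

end Characters

section Conjugation

open modCharacters

variable {p : ℕ} {Ω : Type*} [Group Ω] [TopologicalSpace Ω] [IsTopologicalGroup Ω]

theorem continuous_conjNormal (X : Subgroup Ω) [X.Normal] (c : Ω) :
    Continuous (MulAut.conjNormal c : MulAut X) :=
  Continuous.subtype_mk (by fun_prop : Continuous fun h : X => c * h * c⁻¹) _

/-- The conjugation action `(c • u) h = u (c⁻¹ h c)` of `Ω` on the characters of a normal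
subgroup `X`. -/
def conjRep (p : ℕ) (X : Subgroup Ω) [X.Normal] :
    Representation (ZMod p) Ω (modCharacters p X) where
  toFun c := comap (MulAut.conjNormal c⁻¹ : MulAut X).toMonoidHom (continuous_conjNormal X c⁻¹)
  map_one' := by
    ext u h
    exact congrArg u.1 (Subtype.ext (by simp))
  map_mul' a b := by
    ext u h
    exact congrArg u.1 (Subtype.ext (by simp [mul_assoc]))

variable {X Y : Subgroup Ω} [X.Normal] [Y.Normal]

theorem conjRep_apply (c : Ω) (u : modCharacters p X) (h : X) :
    (conjRep p X c u).1 h = u.1 (MulAut.conjNormal c⁻¹ h) := rfl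

theorem conjRep_apply_eq_of_commute {c : Ω} {h : X} (hc : Commute c h) (u : modCharacters p X) :
    (conjRep p X c u).1 h = u.1 h :=
  congrArg u.1 <| Subtype.ext <| (MulAut.conjNormal_apply c⁻¹ h).trans <| by
    rw [inv_inv, hc.inv_left.eq, inv_mul_cancel_right]

theorem conjRep_of_mem {c : Ω} (hc : c ∈ X) (u : modCharacters p X) : conjRep p X c u = u := by
  ext h
  have hconj : MulAut.conjNormal c⁻¹ h = (⟨c, hc⟩⁻¹ * h * ⟨c, hc⟩ : X) := Subtype.ext (by simp)
  rw [conjRep_apply, hconj, modCharacters.map_mul, modCharacters.map_mul, modCharacters.map_inv]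
  ring

theorem conjRep_eq_of_inv_mul_mem {a b : Ω} (hab : a⁻¹ * b ∈ X) (u : modCharacters p X) :
    conjRep p X a u = conjRep p X b u := by
  conv_lhs => rw [← conjRep_of_mem hab u]
  rw [← Module.End.mul_apply, ← map_mul, mul_inv_cancel_left]

theorem restrict_conjRep (h : Y ≤ X) (c : Ω) (u : modCharacters p X) :
    restrict h (conjRep p X c u) = conjRep p Y c (restrict h u) := rfl

/-- Some character of `X` invariant under `t` is not in the image of the norm
`1 + t + ⋯ + t^(p-1)`. -/
def HasInvariantNonNorm (p : ℕ) (X : Subgroup Ω) [X.Normal] (t : Ω) : Prop :=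
  ∃ u : modCharacters p X, conjRep p X t u = u ∧
    ∀ v : modCharacters p X, ∑ j ∈ range p, conjRep p X (t ^ j) v ≠ u

theorem hasInvariantNonNorm_of_apply_pow_ne_zero {t : Ω} (ht : t ^ p ∈ X)
    {u : modCharacters p X} (hu : conjRep p X t u = u) (hne : u.1 ⟨t ^ p, ht⟩ ≠ 0) :
    HasInvariantNonNorm p X t := by
  refine ⟨u, hu, fun v hv => hne ?_⟩
  have hconst (j : ℕ) : (conjRep p X (t ^ j) v).1 ⟨t ^ p, ht⟩ = v.1 ⟨t ^ p, ht⟩ :=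
    conjRep_apply_eq_of_commute (Commute.pow_pow_self t j p) v
  rw [← hv, Submodule.coe_sum, Finset.sum_apply, sum_congr rfl fun j _ => hconst j]
  simp

theorem apply_mul_pow_eq_of_conjRep_eq {t b : Ω} (hb : b ∈ X) (ht : t ^ p ∈ X)
    (htb : (t * b) ^ p ∈ X) {u : modCharacters p X} (hu : conjRep p X t u = u) :
    u.1 ⟨(t * b) ^ p, htb⟩ = u.1 ⟨t ^ p, ht⟩ := by
  have key (i : ℕ) : ∃ c : X, (t * b) ^ i = t ^ i * c ∧ u.1 c = i * u.1 ⟨b, hb⟩ := by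
    induction i with
    | zero => exact ⟨1, by simp, by simp [modCharacters.map_one]⟩
    | succ i ih =>
      obtain ⟨c, hc, huc⟩ := ih
      refine ⟨MulAut.conjNormal t⁻¹ c * ⟨b, hb⟩, ?_, ?_⟩
      · rw [pow_succ, hc, pow_succ, Subgroup.coe_mul, MulAut.conjNormal_apply]
        group
      · rw [modCharacters.map_mul, ← conjRep_apply, hu, huc]
        push_cast
        ring
  obtain ⟨c, hc, huc⟩ := key p
  have hprod : (⟨(t * b) ^ p, htb⟩ : X) = ⟨t ^ p, ht⟩ * c := Subtype.ext hc
  rw [hprod, modCharacters.map_mul, huc]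
  simp

end Conjugation

section Transfer

open scoped commutatorElement

open modCharacters

theorem transfer_apply_of_mem_normal {G A : Type*} [Group G] [CommGroup A] {H : Subgroup G}
    [H.Normal] [H.FiniteIndex] [Fintype (G ⧸ H)] (f : H →* A) (h : H) :
    f.transfer h = ∏ q : G ⧸ H, f (MulAut.conjNormal (q.out)⁻¹ h) := by
  let T : H.LeftTransversal := ⟨Set.range (Quotient.out : G ⧸ H → G),
    Subgroup.isComplement_range_left fun q => Quotient.out_eq' q⟩
  have hT (q : G ⧸ H) : (T.2.leftQuotientEquiv q : G) = q.out :=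
    Subgroup.IsComplement.leftQuotientEquiv_apply (fun q => Quotient.out_eq' q) q
  have hq (q : G ⧸ H) : (h : G)⁻¹ • q = q := by
    induction q using QuotientGroup.induction_on with
    | H a => exact QuotientGroup.eq.2 (by simpa [mul_assoc] using ‹H.Normal›.conj_mem' h h.2 a)
  rw [MonoidHom.transfer_def f T]
  refine @Fintype.prod_equiv _ _ _ (_) _ _ (Equiv.refl _) _ _ fun q =>
    congrArg f (Subtype.ext ?_)
  simp [T, Subgroup.smul_apply_eq_smul_apply_inv_smul, hT, hq, mul_assoc]

variable {p : ℕ} {Ω : Type*} [Group Ω] [TopologicalSpace Ω] [IsTopologicalGroup Ω]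
  {X Y : Subgroup Ω}

theorem exists_restrict_eq_of_hom (hYX : Y ≤ X) (hY : IsOpen (Y : Set Ω))
    (f : X →* Multiplicative (ZMod p)) (v : modCharacters p Y)
    (hfv : ∀ h : Y, (f (Subgroup.inclusion hYX h)).toAdd = v.1 h) :
    ∃ U : modCharacters p X, restrict hYX U = v := by
  have hopen : IsOpen ((toHom v).ker.map (Subgroup.inclusion hYX) : Set X) :=
    hY.isOpenMap_inclusion hYX _ (isOpen_ker v)
  have hle : (toHom v).ker.map (Subgroup.inclusion hYX) ≤ f.ker := by
    rintro - ⟨h, hh, rfl⟩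
    exact congrArg Multiplicative.ofAdd ((hfv h).trans hh)
  exact ⟨ofHom f (Subgroup.isOpen_mono hle hopen), Subtype.ext (funext hfv)⟩

variable [Y.Normal]

theorem exists_restrict_eq_sum_conjRep (hYX : Y ≤ X) (hY : IsOpen (Y : Set Ω))
    [Y.IsFiniteRelIndex X] [Fintype (X ⧸ Y.subgroupOf X)] (u : modCharacters p Y) :
    ∃ U : modCharacters p X,
      restrict hYX U = ∑ q : X ⧸ Y.subgroupOf X, conjRep p Y (q.out : X) u := by
  let f : Y.subgroupOf X →* Multiplicative (ZMod p) :=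
    (toHom u).comp (Subgroup.subgroupOfEquivOfLe hYX).toMonoidHom
  refine exists_restrict_eq_of_hom hYX hY f.transfer _ fun h => ?_
  refine (congrArg Multiplicative.toAdd
    (transfer_apply_of_mem_normal f ⟨⟨h, hYX h.2⟩, h.2⟩)).trans ?_
  simp only [Submodule.coe_sum, Finset.sum_apply, toAdd_prod]
  rfl

/-- If `t` centralizes `X` modulo `Y`, the transfer to `X` of a `t`-invariant character of `Y` is
`t`-invariant because a multiple prime to `p` of it is determined on `Y`. -/
theorem exists_transfer_of_coprime [Fact p.Prime] [X.Normal] (hYX : Y ≤ X) (hY : IsOpen (Y : Set Ω))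
    (hd : (Y.relIndex X).Coprime p) {t : Ω} (ht : ∀ c ∈ X, c * t * c⁻¹ * t⁻¹ ∈ Y)
    {u : modCharacters p Y} (hu : conjRep p Y t u = u) :
    ∃ U : modCharacters p X, conjRep p X t U = U ∧
      ∀ h : Y, (∀ c ∈ X, (conjRep p Y c u).1 h = u.1 h) →
        U.1 (Subgroup.inclusion hYX h) = Y.relIndex X * u.1 h := by
  have hd0 : (Y.relIndex X : ZMod p) ≠ 0 := ((ZMod.isUnit_iff_coprime _ _).2 hd).ne_zero
  have : Y.IsFiniteRelIndex X := ⟨fun h => hd0 (by rw [h, Nat.cast_zero])⟩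
  let := (Y.subgroupOf X).fintypeQuotientOfFiniteIndex
  obtain ⟨U, hU⟩ := exists_restrict_eq_sum_conjRep hYX hY u
  have htY : restrict hYX (conjRep p X t U) = restrict hYX U := by
    rw [restrict_conjRep, hU, map_sum]
    refine sum_congr rfl fun q _ => ?_
    have hq : (t * (q.out : X))⁻¹ * ((q.out : X) * t) ∈ Y := by
      have := ‹Y.Normal›.mem_comm (a := q.out.1 * t) (b := (t * q.out.1)⁻¹)
        (by simpa [mul_assoc] using ht _ (q.out : X).2)
      exact this
    rw [← Module.End.mul_apply, ← map_mul, conjRep_eq_of_inv_mul_mem hq, map_mul,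
      Module.End.mul_apply, hu]
  refine ⟨U, Subtype.ext (funext fun h => mul_left_cancel₀ hd0 ?_), fun h hh => ?_⟩
  · have hpow : (h : Ω) ^ Y.relIndex X ∈ Y :=
      Subgroup.mem_subgroupOf.1 (Subgroup.pow_index_mem _ h)
    have := congrFun (congrArg Subtype.val htY) ⟨_, hpow⟩
    rw [← modCharacters.map_pow, ← modCharacters.map_pow]
    exact this
  · have := congrFun (congrArg Subtype.val hU) h
    rw [Submodule.coe_sum, Finset.sum_apply, sum_congr rfl fun q _ => hh _ (q.out : X).2] at this
    rw [Subgroup.relIndex, Subgroup.index_eq_card, Nat.card_eq_fintype_card, ← nsmul_eq_mul]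
    exact this.trans (sum_const _)

theorem hasInvariantNonNorm_of_coprime_relIndex [Fact p.Prime] [X.Normal] (hYX : Y ≤ X)
    (hY : IsOpen (Y : Set Ω)) (hd : (Y.relIndex X).Coprime p) {t : Ω}
    (ht : ∀ c ∈ X, c * t * c⁻¹ * t⁻¹ ∈ Y) (htp : t ^ p ∈ Y) {u : modCharacters p Y}
    (hu : conjRep p Y t u = u) (hne : u.1 ⟨t ^ p, htp⟩ ≠ 0) : HasInvariantNonNorm p X t := by
  obtain ⟨U, hUt, hU⟩ := exists_transfer_of_coprime hYX hY hd ht hu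
  refine hasInvariantNonNorm_of_apply_pow_ne_zero (hYX htp) hUt ?_
  have hconj : ∀ c ∈ X, (conjRep p Y c u).1 ⟨t ^ p, htp⟩ = u.1 ⟨t ^ p, htp⟩ := fun c hc => by
    have hb : t⁻¹ * (c⁻¹ * t * c) ∈ Y := by
      have := ‹Y.Normal›.conj_mem' _ (ht c⁻¹ (inv_mem hc)) t
      simpa [mul_assoc] using this
    have hpow : (MulAut.conjNormal c⁻¹ ⟨t ^ p, htp⟩ : Ω) = (t * (t⁻¹ * (c⁻¹ * t * c))) ^ p := by
      simpa using (conj_pow (a := c⁻¹) (b := t) (i := p)).symm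
    rw [← apply_mul_pow_eq_of_conjRep_eq hb htp (hpow ▸ SetLike.coe_mem _) hu, conjRep_apply]
    exact congrArg u.1 (Subtype.ext hpow)
  exact (hU _ hconj).trans_ne (mul_ne_zero ((ZMod.isUnit_iff_coprime _ _).2 hd).ne_zero hne)

theorem exists_sum_conjRep_eq_relIndex_nsmul [Fact p.Prime] [X.Normal] (hYX : Y ≤ X)
    (hY : IsOpen (Y : Set Ω)) (hd : (Y.relIndex X).Coprime p) {t : Ω}
    (ht : ∀ c ∈ X, c * t * c⁻¹ * t⁻¹ ∈ Y) (hX : ¬HasInvariantNonNorm p X t) {u : modCharacters p Y}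
    (hu : conjRep p Y t u = u) (huX : ∀ c ∈ X, conjRep p Y c u = u) :
    ∃ v : modCharacters p Y, ∑ j ∈ range p, conjRep p Y (t ^ j) v = Y.relIndex X • u := by
  obtain ⟨U, hUt, hU⟩ := exists_transfer_of_coprime hYX hY hd ht hu
  simp only [HasInvariantNonNorm, not_exists, not_and, not_forall, not_not] at hX
  obtain ⟨v, hv⟩ := hX U hUt
  refine ⟨restrict hYX v, ?_⟩
  simp only [← restrict_conjRep, ← map_sum, hv]
  ext h
  refine Eq.trans ?_ (nsmul_eq_mul (Y.relIndex X) (u.1 h)).symm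
  exact hU h fun c hc => by rw [huX c hc]

end Transfer

section CyclicFieldAutomorphism

variable {K : Type*} [Field K] {σ : K →+* K}

theorem exists_sum_mul_pow_apply_ne_zero (hσ : IsOfFinOrder σ) {a : ℕ → K} (ha : a 0 ≠ 0) :
    ∃ x, ∑ i ∈ range (orderOf σ), a i * (σ ^ i) x ≠ 0 := by
  let f (i : Fin (orderOf σ)) : K →* K := (σ ^ (i : ℕ) : K →+* K)
  have hf : Function.Injective f := fun i j h => Fin.ext <|
    pow_injOn_Iio_orderOf i.2 j.2 (RingHom.ext fun x => DFunLike.congr_fun h x)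
  have hli := (linearIndependent_monoidHom K K).comp f hf
  by_contra! hcon
  refine ha (Fintype.linearIndependent_iff.1 hli (fun i => a i) (funext fun x => ?_)
    ⟨0, hσ.orderOf_pos⟩)
  rw [Pi.zero_apply, ← hcon x, ← Fin.sum_univ_eq_sum_range (fun i => a i * (σ ^ i) x)]
  simp [f]

theorem map_pow_apply (i : ℕ) (x : K) : σ ((σ ^ i) x) = (σ ^ (i + 1)) x := by
  rw [pow_succ', RingHom.mul_def, RingHom.comp_apply]

theorem map_sum_pow_orderOf (x : K) :
    σ (∑ i ∈ range (orderOf σ), (σ ^ i) x) = ∑ i ∈ range (orderOf σ), (σ ^ i) x := by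
  have := (sum_range_succ' (fun i => (σ ^ i) x) _).symm.trans
    (sum_range_succ (fun i => (σ ^ i) x) (orderOf σ))
  simp only [map_sum, map_pow_apply]
  simpa [pow_orderOf_eq_one] using this

/-- Hilbert's Theorem 90; `groupCohomology.exists_div_of_norm_eq_one` covers only fields in
`Type`. -/
theorem exists_mul_map_eq_of_prod_eq_one (hσ : IsOfFinOrder σ) {b : K}
    (hb : ∏ i ∈ range (orderOf σ), (σ ^ i) b = 1) : ∃ x, x ≠ 0 ∧ b * σ x = x := by
  let c (i : ℕ) : K := ∏ l ∈ range i, (σ ^ l) b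
  have hc (i : ℕ) : b * σ (c i) = c (i + 1) := by
    simp only [c, map_prod, map_pow_apply, prod_range_succ', pow_zero, RingHom.coe_one, id_eq,
      mul_comm]
  obtain ⟨x, hx⟩ := exists_sum_mul_pow_apply_ne_zero hσ (a := c) (by simp [c])
  refine ⟨_, hx, ?_⟩
  have hshift := (sum_range_succ' (fun i => c i * (σ ^ i) x) _).symm.trans
    (sum_range_succ (fun i => c i * (σ ^ i) x) (orderOf σ))
  rw [show c (orderOf σ) = 1 from hb, show c 0 = 1 from prod_range_zero _, pow_orderOf_eq_one,
    pow_zero] at hshift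
  conv_rhs => rw [← add_right_cancel hshift]
  rw [map_sum, mul_sum]
  refine sum_congr rfl fun i _ => ?_
  rw [map_mul, ← mul_assoc, hc, map_pow_apply]

theorem exists_sum_pow_orderOf_eq_one (hσ : IsOfFinOrder σ) :
    ∃ x, ∑ i ∈ range (orderOf σ), (σ ^ i) x = 1 := by
  obtain ⟨x, hx⟩ := exists_sum_mul_pow_apply_ne_zero hσ (a := fun _ => 1) one_ne_zero
  simp only [one_mul] at hx
  refine ⟨x / ∑ i ∈ range (orderOf σ), (σ ^ i) x, ?_⟩
  have hfix (i : ℕ) := RingHom.coe_pow σ i ▸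
    Function.IsFixedPt.iterate (map_sum_pow_orderOf (σ := σ) x) i
  simp only [map_div₀, (hfix _).eq]
  rw [← sum_div, div_self hx]

theorem exists_map_eq_add_of_sum_eq_zero (hσ : IsOfFinOrder σ) {d : K}
    (hd : ∑ i ∈ range (orderOf σ), (σ ^ i) d = 0) : ∃ x, σ x = x + d := by
  obtain ⟨b, hb⟩ := exists_sum_pow_orderOf_eq_one hσ
  let c (i : ℕ) : K := ∑ l ∈ range i, (σ ^ l) d
  have hc (i : ℕ) : σ (c i) = c (i + 1) - d := by
    simp only [c, map_sum, map_pow_apply, sum_range_succ', pow_zero, RingHom.coe_one, id_eq,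
      add_sub_cancel_right]
  have hb' : ∑ i ∈ range (orderOf σ), (σ ^ (i + 1)) b = 1 := by
    rw [← map_one σ, ← hb, map_sum, sum_congr rfl fun i _ => (map_pow_apply i b).symm]
  have hshift := (sum_range_succ' (fun i => c i * (σ ^ i) b) _).symm.trans
    (sum_range_succ (fun i => c i * (σ ^ i) b) (orderOf σ))
  rw [show c (orderOf σ) = 0 from hd, show c 0 = 0 from sum_range_zero _, zero_mul, zero_mul,
    add_zero, add_zero] at hshift
  refine ⟨-∑ i ∈ range (orderOf σ), c i * (σ ^ i) b, ?_⟩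
  calc σ (-∑ i ∈ range (orderOf σ), c i * (σ ^ i) b)
      = -∑ i ∈ range (orderOf σ), (c (i + 1) - d) * (σ ^ (i + 1)) b := by
        simp only [map_neg, map_sum, map_mul, hc, map_pow_apply]
    _ = -∑ i ∈ range (orderOf σ), c i * (σ ^ i) b + d := by
        simp only [sub_mul, sum_sub_distrib, ← mul_sum, hb', hshift]
        ring

end CyclicFieldAutomorphism

section FixedField

open IntermediateField

variable {F S : Type*} [Field F] [Field S] [Algebra F S] {p : ℕ} [Fact p.Prime]
  {X : Subgroup Gal(S/F)} {t : Gal(S/F)}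

theorem apply_mem_fixedField (ht : t ∈ Subgroup.normalizer (X : Set Gal(S/F))) {x : S}
    (hx : x ∈ fixedField X) : t x ∈ fixedField X := by
  rw [mem_fixedField_iff] at hx ⊢
  intro h hh
  have hconj := congrArg t (hx _ ((Subgroup.mem_normalizer_iff''.1 ht h).1 hh))
  simpa only [← AlgEquiv.mul_apply, mul_assoc, mul_inv_cancel_left] using hconj

theorem exists_ringHom_pow_eq_one_iff [IsGalois F S] (hX : IsOpen (X : Set Gal(S/F)))
    (ht : t ∈ Subgroup.normalizer (X : Set Gal(S/F))) :
    ∃ σ : fixedField X →+* fixedField X,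
      (∀ i x, ((σ ^ i) x : S) = (t ^ i) (x : S)) ∧ ∀ i, σ ^ i = 1 ↔ t ^ i ∈ X := by
  let σ : fixedField X →+* fixedField X :=
    (t : S →+* S).restrict _ _ fun _ hx => apply_mem_fixedField ht hx
  have hσ (i : ℕ) (x) : ((σ ^ i) x : S) = (t ^ i) (x : S) := by
    induction i with
    | zero => rfl
    | succ i ih =>
      rw [pow_succ', pow_succ', AlgEquiv.mul_apply, ← ih]
      rfl
  have hfix : (fixedField X).fixingSubgroup = X :=
    InfiniteGalois.fixingSubgroup_fixedField ⟨X, X.isClosed_of_isOpen hX⟩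
  refine ⟨σ, hσ, fun i => ⟨fun h => ?_, fun h => RingHom.ext fun x => Subtype.ext ?_⟩⟩
  · rw [← hfix]
    exact (mem_fixingSubgroup_iff _ _).2 fun x hx => (hσ i ⟨x, hx⟩).symm.trans
      (congrArg Subtype.val (DFunLike.congr_fun h (⟨x, hx⟩ : fixedField X)))
  · exact (hσ i x).trans ((mem_fixedField_iff _ _).1 x.2 _ h)

theorem exists_apply_eq_neg [IsGalois F S] (hX : IsOpen (X : Set Gal(S/F)))
    (ht : t ∈ Subgroup.normalizer (X : Set Gal(S/F))) (ht2 : t ^ 2 ∉ X) (ht4 : (t ^ 2) ^ 2 ∈ X) :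
    ∃ x ∈ fixedField X, x ≠ 0 ∧ t x = -x := by
  obtain ⟨σ, hσ, hσX⟩ := exists_ringHom_pow_eq_one_iff hX ht
  have hσ4 : orderOf σ = 2 ^ (1 + 1) := orderOf_eq_prime_pow (by rwa [hσX, pow_one])
    (by rwa [hσX, pow_add, pow_one, pow_mul])
  obtain ⟨x, hx0, hx⟩ := exists_mul_map_eq_of_prod_eq_one (σ := σ) (b := -1)
    (orderOf_pos_iff.1 (hσ4 ▸ by norm_num)) (by simp [-RingHom.coe_pow, hσ4]; norm_num)
  have hσx : (σ x : S) = t x := hσ 1 x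
  refine ⟨x, x.2, by simpa using hx0, ?_⟩
  rw [← hσx, ← neg_eq_iff_eq_neg]
  simpa using congrArg Subtype.val hx

variable [IsGalois F S] (hX : IsOpen (X : Set Gal(S/F)))
  (ht : t ∈ Subgroup.normalizer (X : Set Gal(S/F))) (htX : t ∉ X) (htp : t ^ p ∈ X)

include hX ht htX htp

theorem exists_ringHom_orderOf_eq_prime :
    ∃ σ : fixedField X →+* fixedField X,
      orderOf σ = p ∧ ∀ i x, ((σ ^ i) x : S) = (t ^ i) (x : S) := by
  obtain ⟨σ, hσ, hσX⟩ := exists_ringHom_pow_eq_one_iff hX ht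
  exact ⟨σ, orderOf_eq_prime ((hσX p).2 htp) fun h => htX (by simpa using (hσX 1).1 (by simpa)), hσ⟩

theorem exists_mul_apply_eq_of_prod_eq_one {b : S} (hbX : b ∈ fixedField X)
    (hb : ∏ i ∈ range p, (t ^ i) b = 1) : ∃ x ∈ fixedField X, x ≠ 0 ∧ b * t x = x := by
  obtain ⟨σ, hσp, hσ⟩ := exists_ringHom_orderOf_eq_prime hX ht htX htp
  obtain ⟨x, hx0, hx⟩ := exists_mul_map_eq_of_prod_eq_one (σ := σ) (b := ⟨b, hbX⟩)
    (orderOf_pos_iff.1 (hσp ▸ (Fact.out : p.Prime).pos))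
    (Subtype.ext (by simpa [-RingHom.coe_pow, -AlgEquiv.coe_pow, hσp, hσ] using hb))
  have hσx : (σ x : S) = t x := hσ 1 x
  exact ⟨x, x.2, by simpa using hx0, hσx ▸ congrArg Subtype.val hx⟩

theorem exists_sum_pow_apply_eq_one : ∃ x ∈ fixedField X, ∑ i ∈ range p, (t ^ i) x = 1 := by
  obtain ⟨σ, hσp, hσ⟩ := exists_ringHom_orderOf_eq_prime hX ht htX htp
  obtain ⟨x, hx⟩ := exists_sum_pow_orderOf_eq_one (σ := σ)
    (orderOf_pos_iff.1 (hσp ▸ (Fact.out : p.Prime).pos))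
  exact ⟨x, x.2, by
    simpa [-RingHom.coe_pow, -AlgEquiv.coe_pow, hσp, hσ] using congrArg Subtype.val hx⟩

theorem exists_apply_eq_add_of_sum_eq_zero {d : S} (hdX : d ∈ fixedField X)
    (hd : ∑ i ∈ range p, (t ^ i) d = 0) : ∃ x ∈ fixedField X, t x = x + d := by
  obtain ⟨σ, hσp, hσ⟩ := exists_ringHom_orderOf_eq_prime hX ht htX htp
  obtain ⟨x, hx⟩ := exists_map_eq_add_of_sum_eq_zero (σ := σ) (d := ⟨d, hdX⟩)
    (orderOf_pos_iff.1 (hσp ▸ (Fact.out : p.Prime).pos))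
    (Subtype.ext (by simpa [-RingHom.coe_pow, -AlgEquiv.coe_pow, hσp, hσ] using hd))
  have hσx : (σ x : S) = t x := hσ 1 x
  exact ⟨x, x.2, hσx ▸ congrArg Subtype.val hx⟩

end FixedField

section ArtinSchreier

open IntermediateField

theorem exists_modCharacters_eq {F S : Type*} [Field F] [Field S] [Algebra F S]
    [Algebra.IsIntegral F S] {p : ℕ} {X : Subgroup Gal(S/F)} {y : S} {f : X → ZMod p}
    (hf : ∀ g h, f (g * h) = f g + f h) (hfy : ∀ h : X, (h : Gal(S/F)) y = y → f h = 0) :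
    ∃ u : modCharacters p X, u.1 = f := by
  let φ : X →* Multiplicative (ZMod p) := MonoidHom.mk' (fun h => .ofAdd (f h)) hf
  have hle : (MulAction.stabilizer Gal(S/F) y).subgroupOf X ≤ φ.ker := fun h hh => hfy h hh
  have hopen : IsOpen (φ.ker : Set X) := Subgroup.isOpen_mono hle
    ((stabilizer_isOpen_of_isIntegral y).preimage continuous_subtype_val)
  exact ⟨modCharacters.ofHom φ hopen, rfl⟩

theorem exists_pow_sub_self_eq {S : Type*} [Field S] [IsSepClosed S] {p : ℕ} [Fact p.Prime]
    [CharP S p] (c : S) : ∃ y : S, y ^ p - y = c := by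
  open Polynomial in
  have hdeg : (-X - C c : S[X]).natDegree ≤ 1 := by compute_degree
  have hlt : (-X - C c : S[X]).natDegree < (X ^ p : S[X]).natDegree := by
    rw [natDegree_X_pow]
    exact hdeg.trans_lt (Fact.out : p.Prime).one_lt
  obtain ⟨y, hy⟩ := IsSepClosed.exists_root (X ^ p + (-X - C c) : S[X])
    (fun h => by
      have := natDegree_add_eq_left_of_natDegree_lt hlt
      rw [natDegree_eq_of_degree_eq_some h, natDegree_X_pow] at this
      exact (Fact.out : p.Prime).ne_zero this.symm)
    (by
      rw [Separable]
      simpa [derivative_X_pow] using isCoprime_one_right.neg_right)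
  exact ⟨y, by simpa [sub_eq_zero, add_sub, ← sub_eq_add_neg] using hy⟩

variable {F S : Type*} [Field F] [Field S] [Algebra F S] {p : ℕ} [CharP S p]

/-- The inclusion of the prime field. -/
abbrev primeFieldHom (p : ℕ) (S : Type*) [Field S] [CharP S p] : ZMod p →+* S :=
  ZMod.castHom dvd_rfl S

theorem apply_primeFieldHom (τ : Gal(S/F)) (a : ZMod p) :
    τ (primeFieldHom p S a) = primeFieldHom p S a :=
  DFunLike.congr_fun (Subsingleton.elim ((τ : S →+* S).comp (primeFieldHom p S)) _) a

variable [Fact p.Prime]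

theorem exists_apply_eq_add_of_apply_pow_sub_self {y b : S} {τ : Gal(S/F)}
    (hτ : τ (y ^ p - y) = y ^ p - y + (b ^ p - b)) :
    ∃ a : ZMod p, τ y = y + b + primeFieldHom p S a := by
  have hfrob : (τ y - y - b) ^ p = τ y - y - b := by
    rw [map_sub, map_pow] at hτ
    rw [sub_pow_char, sub_pow_char]
    linear_combination hτ
  obtain ⟨a, ha⟩ := (bot_le : (⊥ : Subfield S) ≤ (primeFieldHom p S).fieldRange)
    ((Subfield.mem_bot_iff_pow_eq_self S p).2 hfrob)
  exact ⟨a, by rw [ha]; ring⟩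

theorem exists_artinSchreier_character [Algebra.IsIntegral F S] {X : Subgroup Gal(S/F)} {y : S}
    (hy : y ^ p - y ∈ fixedField X) :
    ∃ u : modCharacters p X, ∀ h : X, (h : Gal(S/F)) y = y + primeFieldHom p S (u.1 h) := by
  have hroot (h : X) : ∃ a : ZMod p, (h : Gal(S/F)) y = y + primeFieldHom p S a := by
    have hτ := (mem_fixedField_iff _ _).1 hy h h.2
    simpa using exists_apply_eq_add_of_apply_pow_sub_self (b := (0 : S))
      (hτ.trans (by rw [zero_pow (Fact.out : p.Prime).ne_zero, sub_zero, add_zero]))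
  choose f hf using hroot
  obtain ⟨u, rfl⟩ := exists_modCharacters_eq (f := f) (y := y)
    (fun g h => (primeFieldHom p S).injective <| add_left_cancel (a := y) <| by
      rw [← hf, Subgroup.coe_mul, AlgEquiv.mul_apply, hf, map_add, hf, apply_primeFieldHom,
        map_add, add_assoc])
    (fun h hh => (primeFieldHom p S).injective <| by simpa [hh] using hf h)
  exact ⟨u, hf⟩

theorem hasInvariantNonNorm_of_charP [IsGalois F S] [IsSepClosed S] {X : Subgroup Gal(S/F)}
    [X.Normal] (hX : IsOpen (X : Set Gal(S/F))) {t : Gal(S/F)} (htX : t ∉ X) (htp : t ^ p ∈ X) :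
    HasInvariantNonNorm p X t := by
  have htn : t ∈ Subgroup.normalizer (X : Set Gal(S/F)) := by simp [Subgroup.normalizer_eq_top]
  obtain ⟨b, hb, htrace⟩ := exists_sum_pow_apply_eq_one hX htn htX htp
  have hb' : b ^ p - b ∈ fixedField X := sub_mem (pow_mem hb p) hb
  obtain ⟨c, hc, htc⟩ := exists_apply_eq_add_of_sum_eq_zero hX htn htX htp hb' (by
    simp only [map_sub, map_pow, sum_sub_distrib]
    rw [← sum_pow_char, htrace, one_pow, sub_self])
  obtain ⟨y, hy⟩ := exists_pow_sub_self_eq (p := p) c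
  obtain ⟨a, hty⟩ := exists_apply_eq_add_of_apply_pow_sub_self (hy.symm ▸ htc)
  obtain ⟨u, hu⟩ := exists_artinSchreier_character (X := X) (hy ▸ hc)
  have hpow (i : ℕ) :
      (t ^ i) y = y + ∑ l ∈ range i, (t ^ l) b + i * primeFieldHom p S a := by
    induction i with
    | zero => simp
    | succ i ih =>
      rw [pow_succ, AlgEquiv.mul_apply, hty, map_add, map_add, ih, apply_primeFieldHom,
        sum_range_succ]
      push_cast
      ring
  have hinv : conjRep p X t u = u := by
    ext h
    have hconj := congrArg t (hu (MulAut.conjNormal t⁻¹ h))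
    rw [MulAut.conjNormal_apply, inv_inv, ← AlgEquiv.mul_apply, ← mul_assoc,
      mul_inv_cancel_left, AlgEquiv.mul_apply, hty, map_add, map_add, map_add, hu,
      apply_primeFieldHom, apply_primeFieldHom, hty, (mem_fixedField_iff _ _).1 hb h h.2] at hconj
    refine (primeFieldHom p S).injective ?_
    rw [conjRep_apply]
    linear_combination -hconj
  refine hasInvariantNonNorm_of_apply_pow_ne_zero htp hinv fun h0 => ?_
  simpa [-AlgEquiv.coe_pow, htrace, h0] using (hu ⟨t ^ p, htp⟩).symm.trans (hpow p)

end ArtinSchreier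

section Kummer

open IntermediateField

variable {F S : Type*} [Field F] [Field S] [Algebra F S] {p : ℕ} [Fact p.Prime]
  {ζ : S} (hζ : IsPrimitiveRoot ζ p)

/-- The character `a ↦ ζ ^ a` of `𝔽_p` attached to a primitive `p`-th root of unity `ζ`. -/
abbrev rootChar : AddChar (ZMod p) S := AddChar.zmodChar p hζ.pow_eq_one

theorem rootChar_apply (a : ZMod p) : rootChar hζ a = ζ ^ a.val := rfl

theorem rootChar_one : rootChar hζ 1 = ζ := by
  have : Fact (1 < p) := ⟨(Fact.out : p.Prime).one_lt⟩
  rw [rootChar_apply, ZMod.val_one, pow_one]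

theorem rootChar_injective : Function.Injective (rootChar hζ) := fun a b h =>
  ZMod.val_injective p (hζ.pow_inj a.val_lt b.val_lt h)

theorem rootChar_ne_zero (a : ZMod p) : rootChar hζ a ≠ 0 :=
  pow_ne_zero _ (hζ.ne_zero (Fact.out : p.Prime).ne_zero)

theorem rootChar_natCast_mul (n : ℕ) (a : ZMod p) : rootChar hζ (n * a) = rootChar hζ a ^ n := by
  rw [← nsmul_eq_mul, AddChar.map_nsmul_eq_pow]

theorem rootChar_pow_prime (a : ZMod p) : rootChar hζ a ^ p = 1 := by
  rw [← rootChar_natCast_mul, CharP.cast_eq_zero, zero_mul, AddChar.map_zero_eq_one]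

theorem rootChar_sum {ι : Type*} (s : Finset ι) (f : ι → ZMod p) :
    rootChar hζ (∑ i ∈ s, f i) = ∏ i ∈ s, rootChar hζ (f i) := by
  classical
  induction s using Finset.induction_on with
  | empty => simp
  | insert a s ha ih => rw [sum_insert ha, prod_insert ha, AddChar.map_add_eq_mul, ih]

theorem exists_eq_rootChar_mul {x y : S} (hy : y ≠ 0) (h : x ^ p = y ^ p) :
    ∃ a, x = rootChar hζ a * y := by
  obtain ⟨i, hi, hix⟩ := hζ.eq_pow_of_pow_eq_one (ξ := x / y)
    (by rw [div_pow, h, div_self (pow_ne_zero _ hy)])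
  refine ⟨i, ?_⟩
  rw [rootChar_apply, ZMod.val_natCast_of_lt hi, hix, div_mul_cancel₀ _ hy]

theorem apply_rootChar {τ : Gal(S/F)} {m : ℕ} (hτ : τ ζ = ζ ^ m) (a : ZMod p) :
    τ (rootChar hζ a) = rootChar hζ a ^ m := by
  rw [rootChar_apply, map_pow, hτ, pow_right_comm]

theorem apply_rootChar_of_apply_eq {τ : Gal(S/F)} (hτ : τ ζ = ζ) (a : ZMod p) :
    τ (rootChar hζ a) = rootChar hζ a := by
  rw [rootChar_apply, map_pow, hτ]

theorem rootChar_mem_fixedField {Y : Subgroup Gal(S/F)} (hζY : ζ ∈ fixedField Y) (a : ZMod p) :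
    rootChar hζ a ∈ fixedField Y := pow_mem hζY _

theorem pow_apply_eq_prod_mul {t : Gal(S/F)} {y κ : S} (hty : t y = κ * y) (i : ℕ) :
    (t ^ i) y = (∏ l ∈ range i, (t ^ l) κ) * y := by
  induction i with
  | zero => simp
  | succ i ih => rw [pow_succ, AlgEquiv.mul_apply, hty, map_mul, ih, prod_range_succ]; ring

theorem pow_apply_of_apply_eq {t : Gal(S/F)} {x : S} (ht : t x = x) (i : ℕ) : (t ^ i) x = x := by
  rw [AlgEquiv.coe_pow]
  exact Function.iterate_fixed ht i

variable {Y : Subgroup Gal(S/F)}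

/-- `u` is the Kummer character of `y` on `Y`: `h y = ζ ^ u(h) y` for `h` in `Y`. -/
def IsKummerChar (u : modCharacters p Y) (y : S) : Prop :=
  ∀ h : Y, (h : Gal(S/F)) y = rootChar hζ (u.1 h) * y

theorem exists_isKummerChar [Algebra.IsIntegral F S] (hζY : ζ ∈ fixedField Y) {y : S}
    (hy : y ≠ 0) (hyY : y ^ p ∈ fixedField Y) : ∃ u, IsKummerChar hζ (Y := Y) u y := by
  have hroot (h : Y) : ∃ a, (h : Gal(S/F)) y = rootChar hζ a * y :=
    exists_eq_rootChar_mul hζ hy <| by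
      rw [← map_pow]
      exact (mem_fixedField_iff _ _).1 hyY h h.2
  choose f hf using hroot
  have hfix (h : Y) : (h : Gal(S/F)) ζ = ζ := (mem_fixedField_iff _ _).1 hζY h h.2
  obtain ⟨u, rfl⟩ := exists_modCharacters_eq (f := f) (y := y)
    (fun g h => rootChar_injective hζ <| mul_right_cancel₀ hy <| by
      rw [← hf, Subgroup.coe_mul, AlgEquiv.mul_apply, hf, map_mul, hf,
        apply_rootChar_of_apply_eq hζ (hfix g), AddChar.map_add_eq_mul, mul_left_comm, mul_assoc])
    (fun h hh => rootChar_injective hζ <| mul_right_cancel₀ hy <| by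
      rw [← hf, hh, AddChar.map_zero_eq_one, one_mul])
  exact ⟨u, hf⟩

include hζ in
theorem exists_apply_eq_mul_of_apply_eq_one [IsGalois F S] (hY : IsOpen (Y : Set Gal(S/F)))
    (hζY : ζ ∈ fixedField Y) {v : modCharacters p Y} {g : Y} (hg : v.1 g = 1) :
    ∃ y : S, y ≠ 0 ∧ (g : Gal(S/F)) y = ζ * y ∧ ∀ h : Y, v.1 h = 0 → (h : Gal(S/F)) y = y := by
  let X := (modCharacters.toHom v).ker.map Y.subtype
  have hX (h : Y) : (h : Gal(S/F)) ∈ X ↔ v.1 h = 0 :=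
    Subgroup.mem_map_iff_mem Y.subtype_injective
  have hXY : X ≤ Y := Subgroup.map_subtype_le _
  have hgn : (g : Gal(S/F)) ∈ Subgroup.normalizer (X : Set Gal(S/F)) :=
    Subgroup.mem_normalizer_iff''.2 fun h => by
      by_cases hh : h ∈ Y
      · rw [← Subgroup.coe_inv, show h = (⟨h, hh⟩ : Y) from rfl, ← Subgroup.coe_mul,
          ← Subgroup.coe_mul, hX, hX, modCharacters.map_mul, modCharacters.map_mul,
          modCharacters.map_inv, neg_add_cancel_comm]
      · refine iff_of_false (fun h' => hh (hXY h')) fun h' => hh ?_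
        simpa [Subgroup.mul_mem_cancel_left, Subgroup.mul_mem_cancel_right] using hXY h'
  have hgX : (g : Gal(S/F)) ∉ X := by simp [hX, hg]
  have hgp : (g : Gal(S/F)) ^ p ∈ X := by
    rw [← Subgroup.coe_pow, hX, modCharacters.map_pow, CharP.cast_eq_zero, zero_mul]
  have hgζ : (g : Gal(S/F)) ζ = ζ := (mem_fixedField_iff _ _).1 hζY g g.2
  obtain ⟨y, hyX, hy, hgy⟩ := exists_mul_apply_eq_of_prod_eq_one
    (hY.isOpenMap_subtype_val _ (modCharacters.isOpen_ker v)) hgn hgX hgp (b := ζ⁻¹)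
    (inv_mem (fixedField_le hXY hζY))
    (by simp [pow_apply_of_apply_eq hgζ, -AlgEquiv.coe_pow, hζ.pow_eq_one])
  refine ⟨y, hy, ?_, fun h hh => (mem_fixedField_iff _ _).1 hyX h ((hX h).2 hh)⟩
  rw [← inv_mul_eq_iff_eq_mul₀ (hζ.ne_zero (Fact.out : p.Prime).ne_zero), hgy]

theorem exists_isKummerChar_generator [IsGalois F S] (hY : IsOpen (Y : Set Gal(S/F)))
    (hζY : ζ ∈ fixedField Y) (v : modCharacters p Y) : ∃ y, y ≠ 0 ∧ IsKummerChar hζ v y := by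
  by_cases hv : ∀ h, v.1 h = 0
  · exact ⟨1, one_ne_zero, fun h => by simp [hv]⟩
  obtain ⟨g, hg⟩ : ∃ g, v.1 g = 1 := by
    push Not at hv
    obtain ⟨g, hg⟩ := hv
    refine ⟨g ^ (v.1 g)⁻¹.val, ?_⟩
    rw [modCharacters.map_pow, ZMod.natCast_zmod_val, inv_mul_cancel₀ hg]
  obtain ⟨y, hy, hgy, hker⟩ := exists_apply_eq_mul_of_apply_eq_one hζ hY hζY hg
  refine ⟨y, hy, fun h => ?_⟩
  have hgζ : (g : Gal(S/F)) ζ = ζ := (mem_fixedField_iff _ _).1 hζY g g.2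
  have hrem : v.1 ((g ^ (v.1 h).val)⁻¹ * h) = 0 := by
    rw [modCharacters.map_mul, modCharacters.map_inv, modCharacters.map_pow,
      ZMod.natCast_zmod_val, hg, mul_one, neg_add_cancel]
  calc (h : Gal(S/F)) y
      = ((g : Gal(S/F)) ^ (v.1 h).val) ((((g ^ (v.1 h).val)⁻¹ * h : Y) : Gal(S/F)) y) := by
        rw [← AlgEquiv.mul_apply, ← Subgroup.coe_pow, ← Subgroup.coe_mul, mul_inv_cancel_left]
    _ = rootChar hζ (v.1 h) * y := by
        rw [hker _ hrem, pow_apply_eq_prod_mul hgy,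
          prod_congr rfl fun i _ => pow_apply_of_apply_eq hgζ i, prod_const, card_range,
          rootChar_apply]

variable [Y.Normal]

namespace IsKummerChar

variable {hζ} {u u' : modCharacters p Y} {y y' : S}

/-- Conjugation by `c` multiplies the character by the cyclotomic character `m` of `c`, while
`c y ∈ κ y ^ m` divides it by `m`. -/
theorem conjRep_eq (hu : IsKummerChar hζ u y) (hy : y ≠ 0) {c : Gal(S/F)} {m : ℕ} {κ : S}
    (hcζ : c ζ = ζ ^ m) (hκ : κ ∈ fixedField Y) (hcy : c y = κ * y ^ m) :
    conjRep p Y c u = u := by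
  ext h
  have hconj := congrArg c (hu (MulAut.conjNormal c⁻¹ h))
  rw [MulAut.conjNormal_apply, inv_inv, ← AlgEquiv.mul_apply, ← mul_assoc,
    mul_inv_cancel_left, AlgEquiv.mul_apply, map_mul] at hconj
  have hcy0 : c y ≠ 0 := (map_ne_zero c).2 hy
  refine rootChar_injective hζ (c.injective (mul_right_cancel₀ hcy0 ?_))
  rw [conjRep_apply, ← hconj, hcy, map_mul, (mem_fixedField_iff _ _).1 hκ h h.2, map_pow, hu,
    apply_rootChar hζ hcζ, mul_pow, mul_left_comm]

theorem apply_conjRep (hu : IsKummerChar hζ u y) {t : Gal(S/F)} (ht : t ζ = ζ) :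
    IsKummerChar hζ (conjRep p Y t u) (t y) := fun h => by
  have hconj := congrArg t (hu (MulAut.conjNormal t⁻¹ h))
  rwa [MulAut.conjNormal_apply, inv_inv, ← AlgEquiv.mul_apply, ← mul_assoc,
    mul_inv_cancel_left, AlgEquiv.mul_apply, map_mul, apply_rootChar_of_apply_eq hζ ht] at hconj

omit [Y.Normal]

theorem sum {ι : Type*} {s : Finset ι} {u : ι → modCharacters p Y} {y : ι → S}
    (hu : ∀ i, IsKummerChar hζ (u i) (y i)) : IsKummerChar hζ (∑ i ∈ s, u i) (∏ i ∈ s, y i) :=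
  fun h => by
    rw [Submodule.coe_sum, Finset.sum_apply, rootChar_sum, map_prod, ← prod_mul_distrib]
    exact prod_congr rfl fun i _ => hu i h

theorem nsmul (hu : IsKummerChar hζ u y) (n : ℕ) : IsKummerChar hζ (n • u) (y ^ n) := fun h => by
  rw [map_pow, hu, mul_pow, ← rootChar_natCast_mul, ← nsmul_eq_mul]
  rfl

theorem div_mem_fixedField (hu : IsKummerChar hζ u y) (hu' : IsKummerChar hζ u y') :
    y / y' ∈ fixedField Y := (mem_fixedField_iff _ _).2 fun h hh => by
  rw [map_div₀, hu ⟨h, hh⟩, hu' ⟨h, hh⟩, mul_div_mul_left _ _ (rootChar_ne_zero hζ _)]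

theorem pow_mem_fixedField (hu : IsKummerChar hζ u y) : y ^ p ∈ fixedField Y :=
  (mem_fixedField_iff _ _).2 fun h hh => by
    rw [map_pow, hu ⟨h, hh⟩, mul_pow, rootChar_pow_prime, one_mul]

end IsKummerChar

theorem apply_prod_pow_apply {t : Gal(S/F)} {x : S} (hx : (t ^ p) x = x) :
    t (∏ i ∈ range p, (t ^ i) x) = ∏ i ∈ range p, (t ^ i) x := by
  obtain ⟨n, rfl⟩ := Nat.exists_eq_succ_of_ne_zero (Fact.out : p.Prime).ne_zero
  simp only [map_prod, ← AlgEquiv.mul_apply, ← pow_succ']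
  rw [prod_range_succ, prod_range_succ', hx, pow_zero, AlgEquiv.one_apply]

include hζ in
theorem exists_prod_pow_apply_eq_mul_pow {t : Gal(S/F)} (htζ : t ζ = ζ) {r : S} (hr0 : r ≠ 0)
    (hr : t (r ^ p) = r ^ p) :
    ∃ η : S, η ^ 2 = 1 ∧ η ^ p = 1 ∧ ∏ i ∈ range p, (t ^ i) r = η * r ^ p := by
  obtain ⟨j, hj⟩ := exists_eq_rootChar_mul hζ hr0 ((map_pow t r p).symm.trans hr)
  have hpow (i : ℕ) : (t ^ i) r = rootChar hζ j ^ i * r := by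
    rw [pow_apply_eq_prod_mul hj,
      prod_congr rfl fun i _ => pow_apply_of_apply_eq (apply_rootChar_of_apply_eq hζ htζ j) i,
      prod_const, card_range]
  refine ⟨rootChar hζ j ^ ∑ i ∈ range p, i, ?_, ?_, ?_⟩
  · rw [← pow_mul, sum_range_id_mul_two, pow_mul, rootChar_pow_prime, one_pow]
  · rw [pow_right_comm, rootChar_pow_prime, one_pow]
  · simp only [hpow]
    rw [prod_mul_distrib, prod_pow_eq_pow_sum, prod_const, card_range]

section NonNorm

variable [IsGalois F S] {X : Subgroup Gal(S/F)} [X.Normal]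
  (hYX : Y ≤ X) (hY : IsOpen (Y : Set Gal(S/F))) (hd : (Y.relIndex X).Coprime p)
  (hζY : ζ ∈ fixedField Y) {t : Gal(S/F)} (htX : ∀ c ∈ X, c * t * c⁻¹ * t⁻¹ ∈ Y) (htp : t ^ p ∈ Y)
  (htζ : t ζ = ζ)

include hζ hYX hY hd hζY htX htp htζ

theorem hasInvariantNonNorm_of_prod_ne_one [IsSepClosed S] [NeZero (p : S)] (htY : t ∉ Y) {β : S}
    (hβ : β ∈ fixedField Y) (hN : ∏ i ∈ range p, (t ^ i) β ≠ 1)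
    (hNp : (∏ i ∈ range p, (t ^ i) β) ^ p = 1) : HasInvariantNonNorm p X t := by
  have hp : p ≠ 0 := (Fact.out : p.Prime).ne_zero
  have hβ0 : β ≠ 0 := by
    rintro rfl
    simp [hp] at hNp
  obtain ⟨γ, hγ, hγ0, htγ⟩ := exists_mul_apply_eq_of_prod_eq_one hY
    (by simp [Subgroup.normalizer_eq_top]) htY htp (pow_mem hβ p)
    (by simpa only [map_pow, prod_pow] using hNp)
  obtain ⟨y, rfl⟩ := IsSepClosed.exists_pow_nat_eq γ p
  have hy : y ≠ 0 := ne_zero_pow hp hγ0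
  obtain ⟨j, hj⟩ := exists_eq_rootChar_mul hζ (x := t y) (mul_ne_zero (inv_ne_zero hβ0) hy)
    (by rw [← map_pow, mul_pow, inv_pow, eq_inv_mul_iff_mul_eq₀ (pow_ne_zero p hβ0), htγ])
  rw [← mul_assoc] at hj
  obtain ⟨u, hu⟩ := exists_isKummerChar hζ hζY hy hγ
  have htu := hu.conjRep_eq hy (m := 1) (by rw [htζ, pow_one])
    (mul_mem (rootChar_mem_fixedField hζ hζY j) (inv_mem hβ)) (by rw [hj, pow_one])
  refine hasInvariantNonNorm_of_coprime_relIndex hYX hY hd htX htp htu fun h0 => hN ?_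
  have hyt := hu ⟨t ^ p, htp⟩
  rw [h0, AddChar.map_zero_eq_one] at hyt
  have hprod := mul_right_cancel₀ hy ((pow_apply_eq_prod_mul hj p).symm.trans hyt)
  simp only [map_mul, map_inv₀, prod_mul_distrib, prod_inv_distrib,
    pow_apply_of_apply_eq (apply_rootChar_of_apply_eq hζ htζ j), prod_const, card_range,
    rootChar_pow_prime, one_mul] at hprod
  exact inv_eq_one.1 hprod

/-- If `w ^ d` is a norm of characters then `w ^ d = r ∏ t ^ i y` in the Kummer group, and
`y ^ p r` is the element sought. -/
theorem exists_prod_pow_apply_eq_mul_pow_relIndex (hX : ¬HasInvariantNonNorm p X t) {w : S}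
    (hw : w ≠ 0) (htw : t (w ^ p) = w ^ p) {u : modCharacters p Y} (hu : IsKummerChar hζ u w)
    (huX : ∀ c ∈ X, conjRep p Y c u = u) :
    ∃ z ∈ fixedField Y, ∃ η, z ≠ 0 ∧ η ^ 2 = 1 ∧ η ^ p = 1 ∧
      ∏ i ∈ range p, (t ^ i) z = η * (w ^ p) ^ Y.relIndex X := by
  obtain ⟨a, ha⟩ := exists_eq_rootChar_mul hζ hw ((map_pow t w p).symm.trans htw)
  have htu := hu.conjRep_eq hw (m := 1) (by rw [htζ, pow_one])
    (rootChar_mem_fixedField hζ hζY a) (by rw [ha, pow_one])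
  obtain ⟨v, hv⟩ := exists_sum_conjRep_eq_relIndex_nsmul hYX hY hd htX hX htu huX
  obtain ⟨y, hy, hvy⟩ := exists_isKummerChar_generator hζ hY hζY v
  set P := ∏ i ∈ range p, (t ^ i) y
  set d := Y.relIndex X
  have hP0 : P ≠ 0 := prod_ne_zero_iff.2 fun i _ => (map_ne_zero _).2 hy
  have hP : IsKummerChar hζ (d • u) P :=
    hv ▸ IsKummerChar.sum fun i => hvy.apply_conjRep (pow_apply_of_apply_eq htζ i)
  have hPp : P ^ p = ∏ i ∈ range p, (t ^ i) (y ^ p) := by simp only [P, ← prod_pow, map_pow]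
  have htP : t (P ^ p) = P ^ p := hPp ▸
    apply_prod_pow_apply ((mem_fixedField_iff _ _).1 hvy.pow_mem_fixedField _ htp)
  have hrp : (w ^ d / P) ^ p = (w ^ p) ^ d / P ^ p := by rw [div_pow, pow_right_comm]
  have hr0 : w ^ d / P ≠ 0 := div_ne_zero (pow_ne_zero d hw) hP0
  obtain ⟨η, hη, hηp, hr⟩ := exists_prod_pow_apply_eq_mul_pow hζ htζ hr0
    (by rw [hrp, map_div₀, map_pow t (w ^ p), htw, htP])
  refine ⟨y ^ p * (w ^ d / P), mul_mem hvy.pow_mem_fixedField ((hu.nsmul d).div_mem_fixedField hP),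
    η, mul_ne_zero (pow_ne_zero p hy) hr0, hη, hηp, ?_⟩
  simp only [map_mul (t ^ _), prod_mul_distrib]
  rw [hr, ← hPp, hrp, mul_left_comm, mul_div_cancel₀ _ (pow_ne_zero p hP0)]

end NonNorm

end Kummer

section Existence

open IntermediateField

variable {F S : Type*} [Field F] [Field S] [Algebra F S] {p : ℕ} [Fact p.Prime]

theorem exists_cyclotomicCharacter {ζ : S} (hζ : IsPrimitiveRoot ζ p) :
    ∃ χ : Gal(S/F) →* (ZMod p)ˣ, ∀ τ : Gal(S/F), τ ζ = rootChar hζ (χ τ : ZMod p) := by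
  have hζ0 := hζ.isUnit (Fact.out : p.Prime).ne_zero
  refine ⟨(modularCyclotomicCharacter S hζ.card_rootsOfUnity).comp
    (MulSemiringAction.toRingAut Gal(S/F) S), fun τ => ?_⟩
  exact modularCyclotomicCharacter.spec S hζ.card_rootsOfUnity
    (MulSemiringAction.toRingAut Gal(S/F) S τ) (t := hζ0.unit)
    ((mem_rootsOfUnity _ _).2 (Units.ext (by simpa using hζ.pow_eq_one)))

theorem eq_one_iff_apply_eq_self {ζ : S} (hζ : IsPrimitiveRoot ζ p) {χ : Gal(S/F) →* (ZMod p)ˣ}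
    (hχ : ∀ τ, τ ζ = rootChar hζ (χ τ : ZMod p)) (τ : Gal(S/F)) : χ τ = 1 ↔ τ ζ = ζ := by
  rw [Units.ext_iff, Units.val_one, ← (rootChar_injective hζ).eq_iff, rootChar_one, hχ]

theorem isOpen_ker_of_rootChar [Algebra.IsIntegral F S] {ζ : S} (hζ : IsPrimitiveRoot ζ p)
    {χ : Gal(S/F) →* (ZMod p)ˣ} (hχ : ∀ τ, τ ζ = rootChar hζ (χ τ : ZMod p)) :
    IsOpen (χ.ker : Set Gal(S/F)) := by
  convert stabilizer_isOpen_of_isIntegral (K := F) ζ using 1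
  exact Set.ext (eq_one_iff_apply_eq_self hζ hχ)

theorem coprime_relIndex_inf_ker {Ω : Type*} [Group Ω] (X : Subgroup Ω) (χ : Ω →* (ZMod p)ˣ) :
    ((X ⊓ χ.ker).relIndex X).Coprime p := by
  rw [Subgroup.inf_relIndex_left, Subgroup.relIndex_ker]
  refine Nat.Coprime.of_dvd_left (Subgroup.card_subgroup_dvd_card _) ?_
  rw [Nat.card_eq_fintype_card, ZMod.card_units,
    Nat.coprime_self_sub_left (Fact.out : p.Prime).one_le]
  exact Nat.coprime_one_left p

variable [IsGalois F S] [IsSepClosed S] {X : Subgroup Gal(S/F)} [X.Normal]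

/-- If the Kummer character of a `p`-th root of `ζ` is a norm, then so is a nontrivial power of `ζ`,
which by Hilbert 90 leads to an invariant character that is not a norm. -/
theorem hasInvariantNonNorm_pow_sub_one [NeZero (p : S)] (hp2 : p ≠ 2)
    (hX : IsOpen (X : Set Gal(S/F))) {t : Gal(S/F)} (htX : t ∉ X) (htp : t ^ p ∈ X) :
    HasInvariantNonNorm p X (t ^ (p - 1)) := by
  have hp := (Fact.out : p.Prime)
  obtain ⟨ζ, hζ⟩ := HasEnoughRootsOfUnity.prim (M := S) (n := p)
  have hζ0 : ζ ≠ 0 := hζ.ne_zero hp.ne_zero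
  obtain ⟨χ, hχ⟩ := exists_cyclotomicCharacter (F := F) hζ
  have hker := eq_one_iff_apply_eq_self hζ hχ
  set Y := X ⊓ χ.ker
  have hd : (Y.relIndex X).Coprime p := coprime_relIndex_inf_ker X χ
  have hY : IsOpen (Y : Set Gal(S/F)) := hX.inter (isOpen_ker_of_rootChar hζ hχ)
  have hζY : ζ ∈ fixedField Y := (mem_fixedField_iff _ _).2 fun h hh => (hker h).1 hh.2
  set s := t ^ (p - 1)
  have hsχ : χ s = 1 := by rw [map_pow, ZMod.units_pow_card_sub_one_eq_one]
  have hsζ : s ζ = ζ := (hker s).1 hsχ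
  have hsX : s ∉ X := fun h => htX <| (X.mul_mem_cancel_left h).1 <| by
    rwa [pow_sub_one_mul hp.ne_zero]
  have hsp : s ^ p ∈ Y := ⟨by rw [pow_right_comm]; exact pow_mem htp _, by simp [hsχ]⟩
  have hsY : ∀ c ∈ X, c * s * c⁻¹ * s⁻¹ ∈ Y := fun c hc =>
    ⟨by simpa [mul_assoc] using mul_mem hc (‹X.Normal›.conj_mem _ (inv_mem hc) s), by simp [hsχ]⟩
  by_contra hnon
  obtain ⟨w, hw⟩ := IsSepClosed.exists_pow_nat_eq ζ p
  have hw0 : w ≠ 0 := ne_zero_pow hp.ne_zero (hw.symm ▸ hζ0)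
  obtain ⟨u, hu⟩ := exists_isKummerChar hζ hζY hw0 (hw.symm ▸ hζY)
  have huX (c : Gal(S/F)) : conjRep p Y c u = u := by
    obtain ⟨a, ha⟩ := exists_eq_rootChar_mul hζ (x := c w) (pow_ne_zero (χ c : ZMod p).val hw0)
      (by rw [← map_pow, pow_right_comm, hw, hχ, rootChar_apply])
    exact hu.conjRep_eq hw0 (hχ c) (rootChar_mem_fixedField hζ hζY a) ha
  obtain ⟨z, hz, η, -, hη2, hηp, hN⟩ := exists_prod_pow_apply_eq_mul_pow_relIndex hζ inf_le_left hY
    hd hζY hsY hsp hsζ hnon hw0 (by rwa [hw]) hu fun c _ => huX c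
  have hη : η = 1 :=
    (pow_eq_one_iff_of_coprime ((Nat.coprime_primes Nat.prime_two hp).2 hp2.symm)).1 ⟨hη2, hηp⟩
  rw [hη, one_mul, hw] at hN
  refine hnon (hasInvariantNonNorm_of_prod_ne_one hζ inf_le_left hY hd hζY hsY hsp hsζ
    (fun h => hsX h.1) hz ?_ ?_)
  · rw [hN, Ne, hζ.pow_eq_one_iff_dvd]
    exact fun h => hp.one_lt.ne' (Nat.Coprime.eq_one_of_dvd hd.symm h)
  · rw [hN, pow_right_comm, hζ.pow_eq_one, one_pow]

/-- Let `t α = -α`. If the Kummer character of `√α` is a norm, then `±α` is the norm of some `z`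
under `t ^ 2`, so `-1` is the norm of `t z / z`. -/
theorem hasInvariantNonNorm_two [NeZero (2 : S)] (hX : IsOpen (X : Set Gal(S/F))) {t : Gal(S/F)}
    (ht2 : t ^ 2 ∉ X) (ht4 : (t ^ 2) ^ 2 ∈ X) : HasInvariantNonNorm 2 X (t ^ 2) := by
  have : NeZero ((2 : ℕ) : S) := by simpa
  have h1 : (-1 : S) ≠ 1 := fun h => NeZero.ne (2 : S) (by linear_combination -h)
  have hζ : IsPrimitiveRoot (-1 : S) 2 := IsPrimitiveRoot.mk_of_lt _ two_pos (by simp)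
    fun l hl0 hl2 => by rwa [show l = 1 by lia, pow_one]
  have htn : t ∈ Subgroup.normalizer (X : Set Gal(S/F)) := by simp [Subgroup.normalizer_eq_top]
  have hζX : (-1 : S) ∈ fixedField X := neg_mem (one_mem _)
  have htX : ∀ c ∈ X, c * t ^ 2 * c⁻¹ * (t ^ 2)⁻¹ ∈ X := fun c hc => by
    simpa [mul_assoc] using mul_mem hc (‹X.Normal›.conj_mem _ (inv_mem hc) (t ^ 2))
  have hd : (X.relIndex X).Coprime 2 := by simp
  obtain ⟨α, hα, hα0, htα⟩ := exists_apply_eq_neg hX htn ht2 ht4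
  obtain ⟨w, rfl⟩ := IsSepClosed.exists_pow_nat_eq α 2
  have hw0 : w ≠ 0 := ne_zero_pow two_ne_zero hα0
  obtain ⟨u, hu⟩ := exists_isKummerChar hζ hζX hw0 hα
  by_contra hnon
  obtain ⟨z, hz, η, -, hη2, -, hN⟩ := exists_prod_pow_apply_eq_mul_pow_relIndex hζ le_rfl hX
    hd hζX htX ht4 (by simp) hnon hw0 (by rw [sq t, AlgEquiv.mul_apply, htα, map_neg, htα, neg_neg])
    hu fun c hc => conjRep_of_mem hc u
  have hη : t η = η := by rcases sq_eq_one_iff.1 hη2 with rfl | rfl <;> simp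
  have hη0 : η ≠ 0 := ne_zero_pow two_ne_zero (hη2.symm ▸ one_ne_zero)
  have hNt : ∏ i ∈ range 2, ((t ^ 2) ^ i) (t z) = t (∏ i ∈ range 2, ((t ^ 2) ^ i) z) := by
    simp only [map_prod, ← AlgEquiv.mul_apply, ← pow_mul, ← pow_succ, ← pow_succ']
  have key : ∏ i ∈ range 2, ((t ^ 2) ^ i) (t z / z) = -1 := by
    simp only [map_div₀, prod_div_distrib]
    rw [hNt, hN, Subgroup.relIndex_self, pow_one, map_mul, hη, htα, mul_neg, neg_div,
      div_self (mul_ne_zero hη0 hα0)]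
  exact hnon (hasInvariantNonNorm_of_prod_ne_one hζ le_rfl hX hd hζX htX ht4 (by simp) ht2
    (div_mem (apply_mem_fixedField htn hz) hz) (key.trans_ne h1) (by rw [key, neg_one_sq]))

theorem exists_hasInvariantNonNorm (hX : IsOpen (X : Set Gal(S/F))) {t : Gal(S/F)} (htX : t ∉ X)
    (htp : t ^ p ∈ X) (h2 : p = 2 → ∃ t₀, t = t₀ ^ 2) :
    ∃ s, s ∉ X ∧ s ^ p ∈ X ∧ HasInvariantNonNorm p X s := by
  have hp := (Fact.out : p.Prime)
  by_cases hchar : (p : S) = 0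
  · have : CharP S p := (CharP.charP_iff_prime_eq_zero hp).2 hchar
    exact ⟨t, htX, htp, hasInvariantNonNorm_of_charP hX htX htp⟩
  have : NeZero (p : S) := ⟨hchar⟩
  by_cases hp2 : p = 2
  · subst hp2
    obtain ⟨t₀, rfl⟩ := h2 rfl
    have : NeZero (2 : S) := by simpa
    exact ⟨_, htX, htp, hasInvariantNonNorm_two hX htX htp⟩
  · refine ⟨t ^ (p - 1), fun h => htX ?_, ?_, hasInvariantNonNorm_pow_sub_one hp2 hX htX htp⟩
    · rwa [← X.mul_mem_cancel_left h, pow_sub_one_mul hp.ne_zero]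
    · rw [pow_right_comm]
      exact pow_mem htp _

end Existence

section Nilpotent

variable {E : Type*} [Group E] [Finite E] [Group.IsNilpotent E]

theorem eq_top_of_sup_commutator_eq_top {H : Subgroup E} (hH : H ⊔ commutator E = ⊤) : H = ⊤ := by
  refine (eq_top_or_exists_le_coatom H).resolve_right ?_
  rintro ⟨M, hM, hHM⟩
  have : M.Normal := Subgroup.NormalizerCondition.normal_of_coatom M
    Group.normalizerCondition_of_isNilpotent hM
  have : Nontrivial (E ⧸ M) := QuotientGroup.nontrivial_iff.2 hM.1
  refine (Group.IsSolvable.commutator_lt_top_of_nontrivial (E ⧸ M)).ne ?_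
  have hmk := QuotientGroup.mk'_surjective M
  have hsup : M ⊔ commutator E = ⊤ := top_le_iff.1 (hH ▸ sup_le_sup_right hHM _)
  have hmap := congrArg (Subgroup.map (QuotientGroup.mk' M)) hsup
  rwa [Subgroup.map_sup, QuotientGroup.map_mk'_self, bot_sup_eq, commutator_def,
    Subgroup.map_commutator, Subgroup.map_top_of_surjective _ hmk, ← commutator_def] at hmap

end Nilpotent

section Representation

open Representation

variable {R G V : Type*} [CommRing R] [Group G] [AddCommGroup V] [Module R V]

theorem eq_top_of_ker_norm_le [Fintype G] (hG : (Fintype.card G : R) = 0)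
    (ρ : Representation R G V) {W : Submodule R V} (hW : LinearMap.ker (norm ρ) ≤ W)
    (hinv : ∀ v ∈ W, (∀ g, ρ g v = v) → ∃ w ∈ W, norm ρ w = v) : W = ⊤ := by
  refine eq_top_iff.2 fun v _ => ?_
  have hsub (g : G) : ρ g v - v ∈ W := hW <| by
    rw [LinearMap.mem_ker, map_sub, norm_self_apply, sub_self]
  have hnorm : norm ρ v = ∑ g, (ρ g v - v) := by
    rw [sum_sub_distrib, sum_const, ← Nat.cast_smul_eq_nsmul R, card_univ, hG, zero_smul, sub_zero,
      Representation.norm, LinearMap.sum_apply]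
  obtain ⟨w, hw, hwv⟩ := hinv (norm ρ v) (hnorm ▸ W.sum_mem fun g _ => hsub g) fun g =>
    self_norm_apply ρ g v
  have hvw : v - w ∈ W := hW (by rw [LinearMap.mem_ker, map_sub, hwv, sub_self])
  exact (W.sub_mem_iff_left hw).1 hvw

theorem sum_dual_comp_eq {ρ : Representation R G V} {ι : Type*} {J : Finset ι} {c : ι → G}
    {D : Module.End R V} (hD : ∑ j ∈ J, ρ (c j) * D * ρ (c j)⁻¹ = 1) {l : Module.Dual R V}
    (hl : ∀ j ∈ J, dual ρ (c j) l = l) : ∑ j ∈ J, dual ρ (c j) (l ∘ₗ D) = l := by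
  have hterm (j) (hj : j ∈ J) : dual ρ (c j) (l ∘ₗ D) = l ∘ₗ (ρ (c j) * D * ρ (c j)⁻¹) := by
    ext x
    simpa [-dual_apply, dual] using congrArg (fun f => f (ρ (c j) (D (ρ (c j)⁻¹ x)))) (hl j hj)
  rw [sum_congr rfl hterm]
  ext x
  simpa using congrArg (fun f => l (f x)) hD

end Representation

section GroupAlgebra

/-- The representation of `G` on `R[G]^k` by multiplication by group elements. -/
noncomputable def freeModuleRep (R G : Type*) [CommRing R] [Group G] (k : ℕ) :
    Representation R G (Fin k → MonoidAlgebra R G) :=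
  ((Algebra.lsmul R R (Fin k → MonoidAlgebra R G) : MonoidAlgebra R G →ₐ[R] _) :
    MonoidAlgebra R G →* _).comp (MonoidAlgebra.of R G)

variable {R G : Type*} [CommRing R] [Group G] {k : ℕ}

theorem coeff_freeModuleRep_apply (g h : G) (x : Fin k → MonoidAlgebra R G) (i : Fin k) :
    (freeModuleRep R G k g x i).coeff h = (x i).coeff (g⁻¹ * h) :=
  (MonoidAlgebra.coeff_single_mul_apply ..).trans (one_mul _)

theorem freeModuleAction_apply (g : G) (x : Multiplicative (Fin k → MonoidAlgebra R G)) :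
    freeModuleAction R G k g x = Multiplicative.ofAdd (freeModuleRep R G k g x.toAdd) :=
  rfl

theorem exists_sum_conj_eq_one [Finite G] {ι : Type*} {J : Finset ι} {c : ι → G} {θ : G → R}
    (hθ : ∀ g, ∑ j ∈ J, θ ((c j)⁻¹ * g) = 1) :
    ∃ D : Module.End R (Fin k → MonoidAlgebra R G),
      ∑ j ∈ J, freeModuleRep R G k (c j) * D * freeModuleRep R G k (c j)⁻¹ = 1 := by
  let D : Module.End R (Fin k → MonoidAlgebra R G) :=
    { toFun := fun x i => .ofCoeff (Finsupp.equivFunOnFinite.symm fun g => θ g * (x i).coeff g)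
      map_add' := fun x y => by ext; simp [mul_add]
      map_smul' := fun a x => by ext; simp [mul_left_comm] }
  have hD (x i g) : (D x i).coeff g = θ g * (x i).coeff g := rfl
  refine ⟨D, LinearMap.ext fun x => funext fun i => MonoidAlgebra.ext <| Finsupp.ext fun g => ?_⟩
  simp [MonoidAlgebra.coeff_sum, coeff_freeModuleRep_apply, hD, ← sum_mul, hθ]

open Classical in
theorem exists_sum_pow_translates_eq_one [Finite G] (a : G) :
    ∃ θ : G → R, ∀ g, ∑ j ∈ range (orderOf a), θ ((a ^ j)⁻¹ * g) = 1 := by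
  obtain ⟨T, hT, -⟩ := (Subgroup.zpowers a).exists_isComplement_right 1
  refine ⟨fun g => if (hT.equiv g).1 = 1 then 1 else 0, fun g => ?_⟩
  have hfst (j : ℕ) : (hT.equiv ((a ^ j)⁻¹ * g)).1 = 1 ↔ a ^ j = (hT.equiv g).1 := by
    have hequiv := hT.equiv_mul_left (⟨a, Subgroup.mem_zpowers a⟩ ^ j)⁻¹ g
    rw [Subgroup.coe_inv, Subgroup.coe_pow] at hequiv
    rw [hequiv, inv_mul_eq_one, Subtype.ext_iff, Subgroup.coe_pow]
  obtain ⟨i, hi, hia⟩ := mem_image.1 <| mem_zpowers_iff_mem_range_orderOf.1 (hT.equiv g).1.2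
  rw [sum_eq_single_of_mem i hi fun j hj hji => if_neg fun hj1 => hji ?_]
  · exact if_pos ((hfst i).2 hia)
  · exact pow_injOn_Iio_orderOf (mem_range.1 hj) (mem_range.1 hi) (((hfst j).1 hj1).trans hia.symm)

omit [Group G] in
theorem sum_single_coeff [Fintype G] (x : MonoidAlgebra R G) :
    ∑ g, MonoidAlgebra.single g (x.coeff g) = x := by
  classical
  ext h
  simp [MonoidAlgebra.coeff_sum]

theorem inl_mem_commutator [Fintype G] {x : Fin k → MonoidAlgebra R G}
    (hx : ∀ i, ∑ g, (x i).coeff g = 0) :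
    (SemidirectProduct.inl (Multiplicative.ofAdd x) : FreeModuleSemidirect R G k) ∈
      commutator (FreeModuleSemidirect R G k) := by
  let y (g : G) : Fin k → MonoidAlgebra R G := fun i => MonoidAlgebra.single 1 ((x i).coeff g)
  have hxy : x = ∑ g, (freeModuleRep R G k g (y g) - y g) := by
    refine (funext fun i => ?_ : x = _)
    have hgy (g : G) : freeModuleRep R G k g (y g) i = MonoidAlgebra.single g ((x i).coeff g) :=
      (MonoidAlgebra.single_mul_single ..).trans (by rw [mul_one, one_mul])
    have hy : ∑ g, y g i = 0 := by
      simp only [y, ← map_sum, ← MonoidAlgebra.singleAddHom_apply, hx, map_zero]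
    rw [Finset.sum_apply]
    simp only [Pi.sub_apply, hgy, sum_sub_distrib, hy, sub_zero, sum_single_coeff]
  have hmem (g : G) : (SemidirectProduct.inl (Multiplicative.ofAdd
      (freeModuleRep R G k g (y g) - y g)) : FreeModuleSemidirect R G k) ∈ commutator _ := by
    rw [commutator_def]
    convert Subgroup.commutator_mem_commutator (Subgroup.mem_top (SemidirectProduct.inr g))
      (Subgroup.mem_top (SemidirectProduct.inl (Multiplicative.ofAdd (y g)))) using 1
    rw [commutatorElement_def, ← map_inv SemidirectProduct.inr, ← SemidirectProduct.inl_aut,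
      freeModuleAction_apply, toAdd_ofAdd, ← map_inv, ← map_mul, ofAdd_sub, div_eq_mul_inv]
  rw [hxy, ofAdd_sum]
  exact Subgroup.prod_mem ((commutator (FreeModuleSemidirect R G k)).comap SemidirectProduct.inl)
    fun g _ => hmem g

end GroupAlgebra

section ConjugationQuotient

variable {p : ℕ} {Ω G : Type*} [Group Ω] [TopologicalSpace Ω] [IsTopologicalGroup Ω] [Group G]
  {π : Ω →* G}

/-- The representation of `Ω / ker π ≃ G` on `H¹(ker π, 𝔽_p)` by conjugation. -/
noncomputable def conjRepOfSurjective (p : ℕ) (hπ : Function.Surjective π) :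
    Representation (ZMod p) G (modCharacters p π.ker) where
  toFun g := conjRep p π.ker (Function.surjInv hπ g)
  map_one' := LinearMap.ext <| conjRep_of_mem <| Function.surjInv_eq hπ 1
  map_mul' a b := LinearMap.ext fun u => by
    rw [← map_mul]
    refine conjRep_eq_of_inv_mul_mem ?_ u
    rw [MonoidHom.mem_ker, map_mul, map_inv, map_mul]
    simp only [Function.surjInv_eq, inv_mul_cancel]

theorem conjRepOfSurjective_apply (hπ : Function.Surjective π) (g : G) (u : modCharacters p π.ker) :
    conjRepOfSurjective p hπ g u = conjRep p π.ker (Function.surjInv hπ g) u := rfl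

theorem conjRepOfSurjective_map (hπ : Function.Surjective π) (c : Ω) (u : modCharacters p π.ker) :
    conjRepOfSurjective p hπ (π c) u = conjRep p π.ker c u :=
  conjRep_eq_of_inv_mul_mem (by simp [MonoidHom.mem_ker, Function.surjInv_eq]) u

end ConjugationQuotient

section DualPullback

variable {R G Ω : Type*} [CommRing R] [Group G] [Group Ω] {k : ℕ}

/-- The projection to `G` of a homomorphism to `R[G]^k ⋊ G`. -/
noncomputable abbrev projection (Ψ : Ω →* FreeModuleSemidirect R G k) : Ω →* G :=
  SemidirectProduct.rightHom.comp Ψ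

theorem ker_le_ker_projection (Ψ : Ω →* FreeModuleSemidirect R G k) :
    Ψ.ker ≤ (projection Ψ).ker := fun _ hh =>
  (congrArg SemidirectProduct.right (MonoidHom.mem_ker.1 hh) :)

/-- The homomorphism `ker (projection Ψ) → R[G]^k` induced by `Ψ`. -/
noncomputable def kerLeft (Ψ : Ω →* FreeModuleSemidirect R G k) :
    (projection Ψ).ker →* Multiplicative (Fin k → MonoidAlgebra R G) :=
  MonoidHom.mk' (fun h => (Ψ h).left) fun g h => by
    rw [Subgroup.coe_mul, map_mul, SemidirectProduct.mul_left,
      show (Ψ g).right = 1 from MonoidHom.mem_ker.1 g.2, map_one, MulAut.one_apply]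

theorem inl_kerLeft (Ψ : Ω →* FreeModuleSemidirect R G k) (h : (projection Ψ).ker) :
    SemidirectProduct.inl (kerLeft Ψ h) = Ψ h :=
  SemidirectProduct.ext rfl (MonoidHom.mem_ker.1 h.2).symm

theorem kerLeft_conjNormal (Ψ : Ω →* FreeModuleSemidirect R G k) (c : Ω)
    (h : (projection Ψ).ker) :
    (kerLeft Ψ (MulAut.conjNormal c h)).toAdd =
      freeModuleRep R G k (projection Ψ c) (kerLeft Ψ h).toAdd := by
  rw [← toAdd_ofAdd (freeModuleRep _ _ _ _ _), ← freeModuleAction_apply]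
  refine congrArg Multiplicative.toAdd ?_
  have hconj : Ψ (MulAut.conjNormal c h) = Ψ c * SemidirectProduct.inl (kerLeft Ψ h) * (Ψ c)⁻¹ := by
    rw [inl_kerLeft, MulAut.conjNormal_apply, map_mul, map_mul, map_inv]
  refine (congrArg SemidirectProduct.left hconj).trans ?_
  simp

theorem kerLeft_surjective {Ψ : Ω →* FreeModuleSemidirect R G k} (hΨ : Function.Surjective Ψ) :
    Function.Surjective (kerLeft Ψ) := fun x => by
  obtain ⟨h, hh⟩ := hΨ (SemidirectProduct.inl x)
  exact ⟨⟨h, congrArg SemidirectProduct.right hh⟩, congrArg SemidirectProduct.left hh⟩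

variable {p : ℕ} [TopologicalSpace Ω] [IsTopologicalGroup Ω]
  {Ψ : Ω →* FreeModuleSemidirect (ZMod p) G k} (hopen : IsOpen (Ψ.ker : Set Ω))

/-- The pullback of linear forms on `𝔽_p[G]^k` to characters of `ker (projection Ψ)`. -/
noncomputable def dualPullback : Module.Dual (ZMod p) (Fin k → MonoidAlgebra (ZMod p) G) →ₗ[ZMod p]
    modCharacters p (projection Ψ).ker where
  toFun l := modCharacters.ofHom (l.toAddMonoidHom.toMultiplicative.comp (kerLeft Ψ)) <|
    Subgroup.isOpen_mono (H₁ := Ψ.ker.subgroupOf _) (fun h hh => by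
      have hh1 : kerLeft Ψ h = 1 := congrArg SemidirectProduct.left (Subgroup.mem_subgroupOf.1 hh)
      rw [MonoidHom.mem_ker, MonoidHom.comp_apply, hh1, map_one])
      (hopen.preimage continuous_subtype_val)
  map_add' _ _ := rfl
  map_smul' _ _ := rfl

theorem dualPullback_apply (l : Module.Dual (ZMod p) (Fin k → MonoidAlgebra (ZMod p) G))
    (h : (projection Ψ).ker) : (dualPullback hopen l).1 h = l (kerLeft Ψ h).toAdd := rfl

theorem conjRep_dualPullback (c : Ω)
    (l : Module.Dual (ZMod p) (Fin k → MonoidAlgebra (ZMod p) G)) :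
    conjRep p _ c (dualPullback hopen l) =
      dualPullback hopen ((freeModuleRep (ZMod p) G k).dual (projection Ψ c) l) := by
  ext h
  rw [conjRep_apply, dualPullback_apply, dualPullback_apply, kerLeft_conjNormal, map_inv]
  rfl

theorem dualPullback_injective (hΨ : Function.Surjective Ψ) :
    Function.Injective (dualPullback hopen) := fun l m hlm => LinearMap.ext fun x => by
  obtain ⟨h, hh⟩ := kerLeft_surjective hΨ (Multiplicative.ofAdd x)
  have := congrFun (congrArg Subtype.val hlm) h
  rwa [dualPullback_apply, dualPullback_apply, hh] at this

theorem mem_range_dualPullback (hΨ : Function.Surjective Ψ)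
    {u : modCharacters p (projection Ψ).ker}
    (hu : ∀ h : (projection Ψ).ker, (h : Ω) ∈ Ψ.ker → u.1 h = 0) :
    u ∈ LinearMap.range (dualPullback hopen) := by
  have hker : (kerLeft Ψ).ker ≤ (modCharacters.toHom u).ker := fun h hh =>
    congrArg Multiplicative.ofAdd <| hu h <| by
      rw [MonoidHom.mem_ker, ← inl_kerLeft, MonoidHom.mem_ker.1 hh, map_one]
  let f := (kerLeft Ψ).liftOfSurjective (kerLeft_surjective hΨ) ⟨modCharacters.toHom u, hker⟩
  refine ⟨(AddMonoidHom.toMultiplicative.symm f).toZModLinearMap p, Subtype.ext <| funext fun h =>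
    congrArg Multiplicative.toAdd <| (kerLeft Ψ).liftOfRightInverse_comp_apply _
      (Function.rightInverse_surjInv (kerLeft_surjective hΨ)) ⟨modCharacters.toHom u, hker⟩ h⟩

theorem exists_sum_conjRep_eq [Finite G] (hΨ : Function.Surjective Ψ) {ι : Type*} {J : Finset ι}
    {c : ι → Ω} {θ : G → ZMod p} (hθ : ∀ g, ∑ j ∈ J, θ ((projection Ψ (c j))⁻¹ * g) = 1)
    {u : modCharacters p (projection Ψ).ker} (hu : u ∈ LinearMap.range (dualPullback hopen))
    (huc : ∀ j ∈ J, conjRep p _ (c j) u = u) :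
    ∃ v ∈ LinearMap.range (dualPullback hopen), ∑ j ∈ J, conjRep p _ (c j) v = u := by
  obtain ⟨l, rfl⟩ := hu
  obtain ⟨D, hD⟩ := exists_sum_conj_eq_one (k := k) hθ
  have hl (j) (hj : j ∈ J) :
      (freeModuleRep (ZMod p) G k).dual (projection Ψ (c j)) l = l :=
    dualPullback_injective hopen hΨ ((conjRep_dualPullback hopen (c j) l).symm.trans (huc j hj))
  refine ⟨_, ⟨l ∘ₗ D, rfl⟩, ?_⟩
  simp only [conjRep_dualPullback, ← map_sum, sum_dual_comp_eq hD hl]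

theorem exists_norm_eq_zero_of_hasInvariantNonNorm [Fintype G]
    (hopen : IsOpen (Ψ.ker : Set Ω)) (hΨ : Function.Surjective Ψ)
    (hπ : Function.Surjective (projection Ψ)) {t : Ω} (ht : orderOf (projection Ψ t) = p)
    (hnon : HasInvariantNonNorm p (projection Ψ).ker t) :
    ∃ u, (conjRepOfSurjective p hπ).norm u = 0 ∧
      ∃ h : (projection Ψ).ker, (h : Ω) ∈ Ψ.ker ∧ u.1 h ≠ 0 := by
  classical
  by_contra! hcon
  have htop := eq_top_of_ker_norm_le (R := ZMod p)
    ((ZMod.natCast_eq_zero_iff _ _).2 (ht ▸ orderOf_dvd_card))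
    (conjRepOfSurjective p hπ) (W := LinearMap.range (dualPullback hopen))
    (fun u hu => mem_range_dualPullback hopen hΨ (hcon u hu)) fun u hu hinv => by
      have hθ (g : G) : ∑ a, (Pi.single 1 1 : G → ZMod p)
          ((projection Ψ (Function.surjInv hπ a))⁻¹ * g) = 1 := by
        simp only [Function.surjInv_eq, Pi.single_apply, inv_mul_eq_one, sum_ite_eq',
          mem_univ, if_true]
      obtain ⟨v, hv, hvu⟩ := exists_sum_conjRep_eq hopen hΨ hθ hu fun g _ => hinv g
      refine ⟨v, hv, ?_⟩
      rw [Representation.norm, LinearMap.sum_apply]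
      exact hvu
  obtain ⟨u, hut, hu⟩ := hnon
  obtain ⟨θ, hθ⟩ := exists_sum_pow_translates_eq_one (R := ZMod p) (projection Ψ t)
  have hinv (j : ℕ) : conjRep p _ (t ^ j) u = u := by
    induction j with
    | zero => rw [pow_zero, map_one, Module.End.one_apply]
    | succ j ih => rw [pow_succ, map_mul, Module.End.mul_apply, hut, ih]
  obtain ⟨v, -, hv⟩ := exists_sum_conjRep_eq (J := range p) (c := fun j => t ^ j) (θ := θ) hopen hΨ
    (fun g => by simpa only [map_pow, ht] using hθ g) (htop ▸ Submodule.mem_top : u ∈ _)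
    fun j _ => hinv j
  exact hu v hv

end DualPullback

section FiniteSemidirect

variable {p : ℕ} {G : Type*} [Group G] {k : ℕ}

instance finite_freeModuleSemidirect [Fact p.Prime] [Finite G] :
    Finite (FreeModuleSemidirect (ZMod p) G k) := by
  have : Finite (G →₀ ZMod p) := Finite.of_injective _ DFunLike.coe_injective
  have : Finite (MonoidAlgebra (ZMod p) G) :=
    Finite.of_injective _ MonoidAlgebra.coeff_injective
  have : Finite (Multiplicative (Fin k → MonoidAlgebra (ZMod p) G)) :=
    inferInstanceAs (Finite (Fin k → MonoidAlgebra (ZMod p) G))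
  exact Finite.of_equiv _ SemidirectProduct.equivProd.symm

theorem isPGroup_freeModuleSemidirect (hG : IsPGroup p G) :
    IsPGroup p (FreeModuleSemidirect (ZMod p) G k) := by
  intro e
  obtain ⟨m, hm⟩ := hG e.right
  have he : e ^ p ^ m = SemidirectProduct.inl (e ^ p ^ m).left :=
    SemidirectProduct.ext rfl ((map_pow SemidirectProduct.rightHom e _).trans hm)
  have hx (x : Multiplicative (Fin k → MonoidAlgebra (ZMod p) G)) : x ^ p = 1 :=
    Multiplicative.toAdd.injective <| by
      rw [toAdd_pow, ← Nat.cast_smul_eq_nsmul (ZMod p), CharP.cast_eq_zero, zero_smul, toAdd_one]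
  exact ⟨m + 1, by rw [pow_succ, pow_mul, he, ← map_pow, hx, map_one]⟩

end FiniteSemidirect

section Twist

variable {R G Ω : Type*} [CommRing R] [Group G] [Group Ω] {k : ℕ}

/-- The twist of `Ψ : Ω → R[G]^k ⋊ G` by a 1-cocycle `β : Ω → R[G]^k`. -/
noncomputable def twist (Ψ : Ω →* FreeModuleSemidirect R G k) (β : Ω → Fin k → MonoidAlgebra R G)
    (hβ : ∀ σ τ, β (σ * τ) = β σ + freeModuleRep R G k (projection Ψ σ) (β τ)) :
    Ω →* FreeModuleSemidirect R G k :=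
  MonoidHom.mk' (fun τ => SemidirectProduct.inl (Multiplicative.ofAdd (β τ)) * Ψ τ) fun σ τ => by
    refine SemidirectProduct.ext ?_ (by simp)
    simp only [hβ, ofAdd_add, map_mul, SemidirectProduct.mul_left, SemidirectProduct.left_inl,
      SemidirectProduct.right_inl, SemidirectProduct.mul_right, map_one, MulAut.one_apply, one_mul]
    exact mul_mul_mul_comm _ _ _ _

variable {Ψ : Ω →* FreeModuleSemidirect R G k} {β : Ω → Fin k → MonoidAlgebra R G}
    (hβ : ∀ σ τ, β (σ * τ) = β σ + freeModuleRep R G k (projection Ψ σ) (β τ))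

theorem twist_apply (τ : Ω) :
    twist Ψ β hβ τ = SemidirectProduct.inl (Multiplicative.ofAdd (β τ)) * Ψ τ := rfl

theorem projection_twist : projection (twist Ψ β hβ) = projection Ψ := by
  ext τ
  simp [twist_apply]

theorem mem_ker_twist_iff {τ : Ω} : τ ∈ (twist Ψ β hβ).ker ↔
    Ψ τ = SemidirectProduct.inl (Multiplicative.ofAdd (-β τ)) := by
  rw [MonoidHom.mem_ker, twist_apply, mul_eq_one_iff_eq_inv', ofAdd_neg, map_inv]

theorem twist_surjective [Fintype G] [Finite (FreeModuleSemidirect R G k)]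
    [Group.IsNilpotent (FreeModuleSemidirect R G k)] (hΨ : Function.Surjective Ψ)
    (hβ0 : ∀ h ∈ (projection Ψ).ker, ∀ i, ∑ g, (β h i).coeff g = 0) :
    Function.Surjective (twist Ψ β hβ) := by
  rw [← MonoidHom.range_eq_top]
  refine eq_top_of_sup_commutator_eq_top (eq_top_iff.2 fun e _ => ?_)
  obtain ⟨τ, rfl⟩ := hΨ e
  obtain ⟨h, hh⟩ := hΨ (SemidirectProduct.inl (Multiplicative.ofAdd (-β τ)))
  have hhX : h ∈ (projection Ψ).ker := congrArg SemidirectProduct.right hh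
  have hτ : Ψ τ = SemidirectProduct.inl (Multiplicative.ofAdd (-β h)) * twist Ψ β hβ (h * τ) := by
    rw [map_mul, twist_apply, twist_apply, hh, ofAdd_neg, ofAdd_neg, map_inv, map_inv]
    group
  rw [hτ]
  refine mul_mem (Subgroup.mem_sup_right (inl_mem_commutator fun i => ?_))
    (Subgroup.mem_sup_left ⟨_, rfl⟩)
  have := hβ0 h hhX i
  simpa using this

variable [TopologicalSpace Ω] [IsTopologicalGroup Ω]

theorem isOpen_ker_twist (hopen : IsOpen (Ψ.ker : Set Ω)) (hβ1 : ∀ᶠ τ in nhds 1, β τ = 0) :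
    IsOpen ((twist Ψ β hβ).ker : Set Ω) := by
  refine Subgroup.isOpen_of_mem_nhds _ (g := 1) ?_
  filter_upwards [hopen.mem_nhds Ψ.ker.one_mem, hβ1] with τ hτ hτβ
  rw [SetLike.mem_coe, mem_ker_twist_iff, hτβ, MonoidHom.mem_ker.1 hτ]
  simp

end Twist

section Shapiro

variable {p : ℕ} {Ω G : Type*} [Group Ω] [TopologicalSpace Ω] [Group G] [Finite G]
  {π : Ω →* G} (hπ : Function.Surjective π)

/-- The cocycle of the class corresponding to the character `u` under Shapiro's isomorphism
`H¹(Ω, 𝔽_p[G]) ≃ H¹(ker π, 𝔽_p)`, built from the section `Function.surjInv hπ` of `π`. -/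
noncomputable def shapiroCocycle (u : modCharacters p π.ker) (τ : Ω) : MonoidAlgebra (ZMod p) G :=
  .ofCoeff <| Finsupp.equivFunOnFinite.symm fun g =>
    u.1 ⟨(Function.surjInv hπ g)⁻¹ * τ * Function.surjInv hπ ((π τ)⁻¹ * g), by
      simp [MonoidHom.mem_ker, Function.surjInv_eq]⟩

theorem coeff_shapiroCocycle (u : modCharacters p π.ker) (τ : Ω) (g : G) :
    (shapiroCocycle hπ u τ).coeff g =
      u.1 ⟨(Function.surjInv hπ g)⁻¹ * τ * Function.surjInv hπ ((π τ)⁻¹ * g), by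
        simp [MonoidHom.mem_ker, Function.surjInv_eq]⟩ := rfl

theorem shapiroCocycle_mul (u : modCharacters p π.ker) (σ τ : Ω) :
    shapiroCocycle hπ u (σ * τ) =
      shapiroCocycle hπ u σ + MonoidAlgebra.of (ZMod p) G (π σ) * shapiroCocycle hπ u τ := by
  ext g
  rw [MonoidAlgebra.coeff_add, Finsupp.add_apply, MonoidAlgebra.of_apply,
    MonoidAlgebra.coeff_single_mul_apply, one_mul, coeff_shapiroCocycle, coeff_shapiroCocycle,
    coeff_shapiroCocycle, ← modCharacters.map_mul]
  exact congrArg u.1 (Subtype.ext (by simp [mul_assoc]))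

variable [IsTopologicalGroup Ω]

theorem coeff_shapiroCocycle_of_mem_ker (u : modCharacters p π.ker) (h : π.ker) (g : G) :
    (shapiroCocycle hπ u h).coeff g = (conjRepOfSurjective p hπ g u).1 h := by
  rw [coeff_shapiroCocycle, conjRepOfSurjective_apply, conjRep_apply]
  exact congrArg u.1 (Subtype.ext (by simp [MonoidHom.mem_ker.1 h.2]))

theorem eventually_shapiroCocycle_eq_zero (hX : IsOpen (π.ker : Set Ω))
    (u : modCharacters p π.ker) : ∀ᶠ τ in nhds 1, shapiroCocycle hπ u τ = 0 := by
  have hzero (g : G) : ∀ᶠ τ in nhds (1 : Ω),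
      ∃ h : π.ker, (conjRepOfSurjective p hπ g u).1 h = 0 ∧ (h : Ω) = τ := by
    have hopen := modCharacters.isOpen_ker (conjRepOfSurjective p hπ g u)
    exact (hX.isOpenMap_subtype_val _ hopen).mem_nhds
      ⟨1, one_mem (MonoidHom.ker _), rfl⟩
  filter_upwards [Filter.eventually_all.2 hzero] with τ hτ
  ext g
  obtain ⟨h, hh, rfl⟩ := hτ g
  rw [coeff_shapiroCocycle_of_mem_ker, hh]
  rfl

end Shapiro

section ShapiroTwist

variable {p k : ℕ} {Ω G : Type*} [Group Ω] [TopologicalSpace Ω] [Group G] [Finite G]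

/-- The twist of `Ψ` by the cocycle of `c ⊗ u` under Shapiro's isomorphism, where `c ∈ 𝔽_p^k`. -/
noncomputable def shapiroTwist {Ψ : Ω →* FreeModuleSemidirect (ZMod p) G k}
    (hπ : Function.Surjective (projection Ψ)) (u : modCharacters p (projection Ψ).ker)
    (c : Fin k → ZMod p) : Ω →* FreeModuleSemidirect (ZMod p) G k :=
  twist Ψ (fun τ i => c i • shapiroCocycle hπ u τ) fun σ τ => funext fun i => by
    refine (congrArg (c i • ·) (shapiroCocycle_mul hπ u σ τ)).trans ?_
    rw [smul_add, ← mul_smul_comm]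
    rfl

variable {Ψ : Ω →* FreeModuleSemidirect (ZMod p) G k} (hπ : Function.Surjective (projection Ψ))
  (u : modCharacters p (projection Ψ).ker)

theorem projection_shapiroTwist (c : Fin k → ZMod p) :
    projection (shapiroTwist hπ u c) = projection Ψ :=
  projection_twist _

theorem mem_ker_shapiroTwist_iff {c : Fin k → ZMod p} {τ : Ω} : τ ∈ (shapiroTwist hπ u c).ker ↔
    Ψ τ = SemidirectProduct.inl (Multiplicative.ofAdd (-fun i => c i • shapiroCocycle hπ u τ)) :=
  mem_ker_twist_iff _

variable [IsTopologicalGroup Ω]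

theorem isOpen_ker_shapiroTwist (hopen : IsOpen (Ψ.ker : Set Ω)) (c : Fin k → ZMod p) :
    IsOpen ((shapiroTwist hπ u c).ker : Set Ω) := by
  have hX : IsOpen ((projection Ψ).ker : Set Ω) :=
    Subgroup.isOpen_mono (ker_le_ker_projection Ψ) hopen
  refine isOpen_ker_twist _ hopen ?_
  filter_upwards [eventually_shapiroCocycle_eq_zero hπ hX u] with τ hτ
  simp only [hτ, smul_zero]
  rfl

variable [Fact p.Prime]

theorem shapiroTwist_surjective [Fintype G] (hG : IsPGroup p G) (hΨ : Function.Surjective Ψ)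
    {u : modCharacters p (projection Ψ).ker} (hu : (conjRepOfSurjective p hπ).norm u = 0)
    (c : Fin k → ZMod p) : Function.Surjective (shapiroTwist hπ u c) := by
  have : Group.IsNilpotent (FreeModuleSemidirect (ZMod p) G k) :=
    (isPGroup_freeModuleSemidirect hG).isNilpotent
  refine twist_surjective _ hΨ fun h hh i => ?_
  have hsum := congrFun (congrArg Subtype.val hu) ⟨h, hh⟩
  rw [Representation.norm, LinearMap.sum_apply, Submodule.coe_sum, Finset.sum_apply] at hsum
  simp only [MonoidAlgebra.coeff_smul, Finsupp.smul_apply, ← smul_sum,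
    coeff_shapiroCocycle_of_mem_ker hπ u ⟨h, hh⟩, hsum]
  exact smul_zero _

theorem ker_shapiroTwist_injective (hΨ : Function.Surjective Ψ)
    {u : modCharacters p (projection Ψ).ker} {h : (projection Ψ).ker} (hh : (h : Ω) ∈ Ψ.ker)
    (hne : u.1 h ≠ 0) (hsurj : ∀ c, Function.Surjective (shapiroTwist hπ u c)) :
    Function.Injective fun c => (shapiroTwist hπ u c).ker := by
  intro c c' (hcc : (shapiroTwist hπ u c).ker = (shapiroTwist hπ u c').ker)
  by_contra hcne
  obtain ⟨i, hi⟩ := Function.ne_iff.1 hcne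
  have hzero (τ) (hτ : τ ∈ (shapiroTwist hπ u c).ker) : shapiroCocycle hπ u τ = 0 := by
    have heq := (mem_ker_shapiroTwist_iff hπ u).1 (hcc ▸ hτ)
    rw [(mem_ker_shapiroTwist_iff hπ u).1 hτ, SemidirectProduct.inl_inj] at heq
    have hci := congrFun (neg_inj.1 (Multiplicative.ofAdd.injective heq)) i
    rw [← sub_eq_zero, ← sub_smul] at hci
    exact (smul_eq_zero.1 hci).resolve_left (sub_ne_zero.2 hi)
  have hle : (shapiroTwist hπ u c).ker ≤ Ψ.ker := fun τ hτ => by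
    have heq := (mem_ker_shapiroTwist_iff hπ u).1 hτ
    simp only [hzero τ hτ, smul_zero, ← Pi.zero_def] at heq
    exact heq.trans (by simp)
  have hindex : (shapiroTwist hπ u c).ker.index = Ψ.ker.index := by
    rw [Subgroup.index_ker, Subgroup.index_ker, MonoidHom.range_eq_top.2 (hsurj c),
      MonoidHom.range_eq_top.2 hΨ]
  have hker : (shapiroTwist hπ u c).ker = Ψ.ker := by
    have : (shapiroTwist hπ u c).ker.FiniteIndex := inferInstance
    exact hle.eq_of_not_lt fun hlt => (Subgroup.index_strictAnti hlt).ne' hindex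
  have hcoeff := coeff_shapiroCocycle_of_mem_ker hπ u h (projection Ψ 1)
  rw [hzero h (hker ▸ hh), conjRepOfSurjective_map,
    conjRep_of_mem (one_mem _)] at hcoeff
  exact hne hcoeff.symm

end ShapiroTwist

section Existence

variable {p k : ℕ} [Fact p.Prime] {F S G : Type*} [Field F] [Field S] [Algebra F S] [IsGalois F S]
  [IsSepClosed S] [Group G]

theorem exists_orderOf_eq_prime [Finite G] [Nontrivial G] (hG : IsPGroup p G)
    (hG2 : p = 2 → ∃ g : G, g ^ 2 ≠ 1) :
    ∃ a : G, orderOf a = p ∧ (p = 2 → ∃ b, a = b ^ 2) := by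
  by_cases hp2 : p = 2
  · subst hp2
    obtain ⟨g, hg⟩ := hG2 rfl
    obtain ⟨n, hn⟩ := IsPGroup.iff_orderOf.1 hG g
    have hn2 : ¬n ≤ 1 := fun h => hg <| orderOf_dvd_iff_pow_eq_one.1 <| by
      simpa only [hn, pow_one] using pow_dvd_pow 2 h
    have h4 : 2 ^ 2 ∣ orderOf g := hn ▸ pow_dvd_pow 2 (not_le.1 hn2)
    have hb := orderOf_pow_orderOf_div (orderOf_pos g).ne' h4
    refine ⟨(g ^ (orderOf g / 2 ^ 2)) ^ 2, ?_, fun _ => ⟨_, rfl⟩⟩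
    rw [orderOf_pow_of_dvd two_ne_zero (by rw [hb]; norm_num), hb]
    rfl
  · obtain ⟨n, hn, hcard⟩ := hG.nontrivial_iff_card.1 ‹_›
    obtain ⟨a, ha⟩ := exists_prime_orderOf_dvd_card' p (hcard ▸ dvd_pow_self p hn.ne')
    exact ⟨a, ha, fun h => absurd h hp2⟩

theorem exists_family_of_surjective [Finite G] [Nontrivial G] (hG : IsPGroup p G)
    (hG2 : p = 2 → ∃ g : G, g ^ 2 ≠ 1) {Ψ : Gal(S/F) →* FreeModuleSemidirect (ZMod p) G k}
    (hΨ : Function.Surjective Ψ) (hopen : IsOpen (Ψ.ker : Set Gal(S/F))) :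
    ∃ Φ : (Fin k → ZMod p) → (Gal(S/F) →* FreeModuleSemidirect (ZMod p) G k),
      (∀ c, projection (Φ c) = projection Ψ) ∧ (∀ c, Function.Surjective (Φ c)) ∧
      (∀ c, IsOpen ((Φ c).ker : Set Gal(S/F))) ∧ Function.Injective fun c => (Φ c).ker := by
  have := Fintype.ofFinite G
  have hπ : Function.Surjective (projection Ψ) := SemidirectProduct.rightHom_surjective.comp hΨ
  have hX : IsOpen ((projection Ψ).ker : Set Gal(S/F)) :=
    Subgroup.isOpen_mono (ker_le_ker_projection Ψ) hopen
  obtain ⟨t, htp, ht2⟩ : ∃ t : Gal(S/F), orderOf (projection Ψ t) = p ∧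
      (p = 2 → ∃ t₀, t = t₀ ^ 2) := by
    obtain ⟨a, ha, ha2⟩ := exists_orderOf_eq_prime hG hG2
    by_cases hp2 : p = 2
    · obtain ⟨b, rfl⟩ := ha2 hp2
      obtain ⟨t₀, rfl⟩ := hπ b
      exact ⟨t₀ ^ 2, by rw [map_pow, ha], fun _ => ⟨t₀, rfl⟩⟩
    · obtain ⟨t, rfl⟩ := hπ a
      exact ⟨t, ha, fun h => absurd h hp2⟩
  obtain ⟨htX, htpX⟩ := orderOf_eq_prime_iff.1 htp
  obtain ⟨s, hsX, hsp, hnon⟩ := exists_hasInvariantNonNorm (p := p) hX htpX (by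
    rwa [MonoidHom.mem_ker, map_pow]) ht2
  have hs : orderOf (projection Ψ s) = p :=
    orderOf_eq_prime (by rwa [MonoidHom.mem_ker, map_pow] at hsp) hsX
  obtain ⟨u, hu, h, hh, hne⟩ := exists_norm_eq_zero_of_hasInvariantNonNorm hopen hΨ hπ hs hnon
  have hsurj := shapiroTwist_surjective hπ hG hΨ hu
  exact ⟨shapiroTwist hπ u, projection_shapiroTwist hπ u, hsurj,
    isOpen_ker_shapiroTwist hπ u hopen, ker_shapiroTwist_injective hπ hΨ hh hne hsurj⟩

end Existence

section GaloisCorrespondence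

variable {F : Type*} [Field F]

instance isGalois_restrict (L : IntermediateField F (AlgebraicClosure F)) [IsGalois F L] :
    IsGalois F (IntermediateField.restrict (le_separableClosure F _ L)) :=
  IsGalois.of_algEquiv (IntermediateField.restrictAlgEquiv _)

/-- The restriction homomorphism from the absolute Galois group to `Gal(L/F)`. -/
noncomputable def absGalRestrict (L : IntermediateField F (AlgebraicClosure F)) [IsGalois F L] :
    Gal(SeparableClosure F/F) →* Gal(L/F) :=
  (AlgEquiv.autCongr (IntermediateField.restrictAlgEquiv _)).symm.toMonoidHom.comp
    (AlgEquiv.restrictNormalHom (IntermediateField.restrict (le_separableClosure F _ L)))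

variable {L : IntermediateField F (AlgebraicClosure F)} [IsGalois F L]

theorem absGalRestrict_apply (τ : Gal(SeparableClosure F/F)) (x : L) :
    (absGalRestrict L τ x : AlgebraicClosure F) =
      τ (IntermediateField.inclusion (le_separableClosure F _ L) x) := by
  let e := IntermediateField.restrictAlgEquiv (le_separableClosure F _ L)
  have h := congrArg Subtype.val (AlgEquiv.restrictNormalHom_apply
    (IntermediateField.restrict (le_separableClosure F _ L)) τ (e x))
  refine Eq.trans ?_ h
  exact congrArg (fun y : IntermediateField.restrict (le_separableClosure F _ L) =>
    ((y : SeparableClosure F) : AlgebraicClosure F))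
    (e.apply_symm_apply (AlgEquiv.restrictNormalHom _ τ (e x)))

theorem absGalRestrict_surjective : Function.Surjective (absGalRestrict L) :=
  (AlgEquiv.autCongr (IntermediateField.restrictAlgEquiv _)).symm.surjective.comp
    (AlgEquiv.restrictNormalHom_surjective (SeparableClosure F))

theorem ker_absGalRestrict : (absGalRestrict L).ker =
    (IntermediateField.restrict (le_separableClosure F _ L)).fixingSubgroup := by
  ext τ
  rw [MonoidHom.mem_ker, IntermediateField.mem_fixingSubgroup_iff]
  refine ⟨fun h x hx => Subtype.ext ?_, fun h => AlgEquiv.ext fun x => Subtype.ext ?_⟩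
  · have := absGalRestrict_apply τ ⟨x, (IntermediateField.mem_restrict _ x).1 hx⟩
    rw [h] at this
    exact this.symm
  · rw [absGalRestrict_apply, h _ ((IntermediateField.mem_restrict _ _).2 x.2)]
    rfl

theorem isOpen_ker_absGalRestrict [Finite Gal(L/F)] :
    IsOpen ((absGalRestrict L).ker : Set Gal(SeparableClosure F/F)) := by
  have : (absGalRestrict L).ker.FiniteIndex := ⟨by
    rw [Subgroup.index_ker]
    exact Nat.card_pos.ne'⟩
  refine Subgroup.isOpen_of_isClosed_of_finiteIndex _ ?_
  rw [ker_absGalRestrict]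
  exact InfiniteGalois.fixingSubgroup_isClosed _

variable {E : Type*} [Group E] {Φ : Gal(SeparableClosure F/F) →* E}

/-- The fixed field of the kernel of a homomorphism from the absolute Galois group. -/
noncomputable def kerField (Φ : Gal(SeparableClosure F/F) →* E) :
    IntermediateField F (AlgebraicClosure F) :=
  IntermediateField.lift (IntermediateField.fixedField Φ.ker)

instance isGalois_kerField : IsGalois F (kerField Φ) :=
  have : IsGalois F (IntermediateField.fixedField Φ.ker) :=
    IsGalois.of_fixedField_normal_subgroup _
  IsGalois.of_algEquiv (IntermediateField.liftAlgEquiv _)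

theorem ker_absGalRestrict_kerField (hopen : IsOpen (Φ.ker : Set Gal(SeparableClosure F/F))) :
    (absGalRestrict (kerField Φ)).ker = Φ.ker := by
  rw [ker_absGalRestrict]
  have : IntermediateField.restrict (le_separableClosure F _ (kerField Φ)) =
      IntermediateField.fixedField Φ.ker :=
    IntermediateField.lift_injective _ (IntermediateField.lift_restrict _)
  rw [this]
  exact InfiniteGalois.fixingSubgroup_fixedField ⟨Φ.ker, Φ.ker.isClosed_of_isOpen hopen⟩

theorem exists_mulEquiv_kerField (hΦ : Function.Surjective Φ)
    (hopen : IsOpen (Φ.ker : Set Gal(SeparableClosure F/F))) :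
    ∃ ψ : Gal(kerField Φ/F) ≃* E, ∀ τ, ψ (absGalRestrict (kerField Φ) τ) = Φ τ := by
  let e := QuotientGroup.liftEquiv Φ.ker absGalRestrict_surjective
    (ker_absGalRestrict_kerField hopen).symm
  refine ⟨e.symm.trans (QuotientGroup.quotientKerEquivOfSurjective Φ hΦ), fun τ => ?_⟩
  have : e.symm (absGalRestrict (kerField Φ) τ) = τ := e.symm_apply_apply τ
  rw [MulEquiv.trans_apply, this]
  rfl

theorem kerField_injective {ι : Type*} {Φ : ι → (Gal(SeparableClosure F/F) →* E)}
    (hopen : ∀ c, IsOpen ((Φ c).ker : Set Gal(SeparableClosure F/F)))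
    (hinj : Function.Injective fun c => (Φ c).ker) :
    Function.Injective fun c => kerField (Φ c) := fun c c' h =>
  hinj <| by
    simp only [← ker_absGalRestrict_kerField (hopen _)]
    simp only [ker_absGalRestrict]
    congr! 2

end GaloisCorrespondence

section EmbeddingProblem

variable {F : Type*} [Field F] {E G : Type*} [Group E] [Group G] {π : E →* G}
  {K L : IntermediateField F (AlgebraicClosure F)} {φ : Gal(K/F) ≃* G}

/-- `f`, a homomorphism from the absolute Galois group to `G`, is restriction to `K` read through
`φ : Gal(K/F) ≃ G`. Elements of `K` enter as elements of the separable closure with the same image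
in the algebraic closure. -/
def IsRestrictionVia (φ : Gal(K/F) ≃* G) (f : Gal(SeparableClosure F/F) →* G) : Prop :=
  ∀ τ (x : K) (y : SeparableClosure F), (y : AlgebraicClosure F) = x →
    (τ y : AlgebraicClosure F) = φ.symm (f τ) x

theorem isRestrictionVia_iff [IsGalois F L] (hKL : K ≤ L) (ψ : Gal(L/F) ≃* E) :
    IsRestrictionVia φ (π.comp ((ψ : Gal(L/F) →* E).comp (absGalRestrict L))) ↔
      ∀ (τ : Gal(L/F)) (x : K), τ (IntermediateField.inclusion hKL x) =
        IntermediateField.inclusion hKL (φ.symm (π (ψ τ)) x) := by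
  rw [absGalRestrict_surjective.forall]
  refine forall_congr' fun τ => forall_congr' fun x => ?_
  rw [Subtype.ext_iff, absGalRestrict_apply]
  exact ⟨fun h => h _ rfl, fun h y hy => (congrArg (fun z => (τ z : AlgebraicClosure F))
    (Subtype.ext hy)).trans h⟩

theorem IsRestrictionVia.le_kerField {Φ : Gal(SeparableClosure F/F) →* E}
    (h : IsRestrictionVia φ (π.comp Φ)) (hK : K ≤ separableClosure F (AlgebraicClosure F)) :
    K ≤ kerField Φ := fun x hx => by
  let y : SeparableClosure F := ⟨x, hK hx⟩
  refine (IntermediateField.mem_lift y).2 ((IntermediateField.mem_fixedField_iff _ _).2 ?_)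
  refine fun τ hτ => Subtype.ext ((h τ ⟨x, hx⟩ y rfl).trans ?_)
  rw [MonoidHom.comp_apply, MonoidHom.mem_ker.1 hτ, map_one, map_one]
  rfl

theorem isOpen_ker_comp_absGalRestrict [Finite E] [IsGalois F L] (ψ : Gal(L/F) ≃* E) :
    IsOpen (((ψ : Gal(L/F) →* E).comp (absGalRestrict L)).ker :
      Set Gal(SeparableClosure F/F)) := by
  have : Finite Gal(L/F) := Finite.of_equiv E ψ.symm.toEquiv
  rw [MonoidHom.ker_mulEquiv_comp]
  exact isOpen_ker_absGalRestrict

theorem IsRestrictionVia.solvesEmbeddingProblem {Φ : Gal(SeparableClosure F/F) →* E}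
    (h : IsRestrictionVia φ (π.comp Φ)) (hK : K ≤ separableClosure F (AlgebraicClosure F))
    (hΦ : Function.Surjective Φ) (hopen : IsOpen (Φ.ker : Set Gal(SeparableClosure F/F))) :
    SolvesEmbeddingProblem π K φ (kerField Φ) := by
  obtain ⟨ψ, hψ⟩ := exists_mulEquiv_kerField hΦ hopen
  have hcomp : (ψ : Gal(kerField Φ/F) →* E).comp (absGalRestrict _) = Φ := MonoidHom.ext hψ
  exact ⟨isGalois_kerField, h.le_kerField hK, ψ, (isRestrictionVia_iff _ ψ).1 (hcomp.symm ▸ h)⟩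

end EmbeddingProblem

theorem natCast_pow_le_encard {p k : ℕ} [NeZero p] {α : Type*} {A : Set α}
    {f : (Fin k → ZMod p) → α} (hf : Function.Injective f) (hA : ∀ c, f c ∈ A) :
    ((p ^ k : ℕ) : ℕ∞) ≤ A.encard :=
  calc ((p ^ k : ℕ) : ℕ∞) = ENat.card (Fin k → ZMod p) := by
        rw [ENat.card_eq_coe_fintype_card, Fintype.card_fun, ZMod.card, Fintype.card_fin]
    _ ≤ (Set.range f).encard := hf.encard_range
    _ ≤ A.encard := Set.encard_le_encard (Set.range_subset_iff.2 hA)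

section MainTheorem

variable {p k : ℕ} [Fact p.Prime] {G : Type v} [Group G] [Finite G] [Nontrivial G]

theorem pow_le_extensionCount (hG : IsPGroup p G) (hG2 : p = 2 → ∃ g : G, g ^ 2 ≠ 1)
    {F : Type*} [Field F] (hF : Realizes (FreeModuleSemidirect (ZMod p) G k) F) :
    ((p ^ k : ℕ) : ℕ∞) ≤ extensionCount (FreeModuleSemidirect (ZMod p) G k) F := by
  obtain ⟨L, _, ⟨ψ⟩⟩ := Set.one_le_encard_iff_nonempty.1 hF
  have : IsSepClosed (SeparableClosure F) := IsSepClosure.sep_closed F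
  obtain ⟨Φ, -, hsurj, hopen, hinj⟩ := exists_family_of_surjective hG hG2
    (ψ.surjective.comp absGalRestrict_surjective) (isOpen_ker_comp_absGalRestrict ψ)
  refine natCast_pow_le_encard (kerField_injective hopen hinj) fun c => ⟨isGalois_kerField, ?_⟩
  obtain ⟨ψ, -⟩ := exists_mulEquiv_kerField (hsurj c) (hopen c)
  exact ⟨ψ⟩

theorem pow_le_encard_solvesEmbeddingProblem (hG : IsPGroup p G)
    (hG2 : p = 2 → ∃ g : G, g ^ 2 ≠ 1) {F : Type*} [Field F]
    {K : IntermediateField F (AlgebraicClosure F)} {φ : Gal(K/F) ≃* G}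
    (hsol : ∃ L, SolvesEmbeddingProblem
      (SemidirectProduct.rightHom : FreeModuleSemidirect (ZMod p) G k →* G) K φ L) :
    ((p ^ k : ℕ) : ℕ∞) ≤ Set.encard {L | SolvesEmbeddingProblem
      (SemidirectProduct.rightHom : FreeModuleSemidirect (ZMod p) G k →* G) K φ L} := by
  obtain ⟨L, _, hKL, ψ, hψ⟩ := hsol
  have : IsSepClosed (SeparableClosure F) := IsSepClosure.sep_closed F
  obtain ⟨Φ, hproj, hsurj, hopen, hinj⟩ := exists_family_of_surjective hG hG2
    (ψ.surjective.comp absGalRestrict_surjective) (isOpen_ker_comp_absGalRestrict ψ)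
  refine natCast_pow_le_encard (kerField_injective hopen hinj) fun c => ?_
  have hc : IsRestrictionVia φ (projection (Φ c)) :=
    hproj c ▸ (isRestrictionVia_iff hKL ψ).2 hψ
  exact hc.solvesEmbeddingProblem (hKL.trans (le_separableClosure F _ L)) (hsurj c) (hopen c)

theorem theorem1p1_general (hG : IsPGroup p G) (hG2 : p = 2 → ∃ g : G, g ^ 2 ≠ 1) :
    ((p ^ k : ℕ) : ℕ∞) ≤
        realizationMultiplicity.{u, v} (FreeModuleSemidirect (ZMod p) G k) ∧
      ∀ (F : Type u) [Field F] (K : IntermediateField F (AlgebraicClosure F)) (φ : Gal(K/F) ≃* G),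
        (∃ L, SolvesEmbeddingProblem
          (SemidirectProduct.rightHom : FreeModuleSemidirect (ZMod p) G k →* G) K φ L) →
        ((p ^ k : ℕ) : ℕ∞) ≤
          Set.encard {L | SolvesEmbeddingProblem
            (SemidirectProduct.rightHom : FreeModuleSemidirect (ZMod p) G k →* G) K φ L} :=
  ⟨le_sInf fun _ ⟨_, _, hF, hm⟩ => hm ▸ pow_le_extensionCount hG hG2 hF,
    fun _ _ _ _ => pow_le_encard_solvesEmbeddingProblem hG hG2⟩

end MainTheorem

theorem exists_sq_ne_one_cyclicPPow {p n : ℕ} (h : ¬p ^ n ∣ 2) :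
    ∃ g : CyclicPPow p n, g ^ 2 ≠ 1 :=
  ⟨Multiplicative.ofAdd 1, fun hg => h <| (ZMod.natCast_eq_zero_iff _ _).1 <| by
    simpa using congrArg Multiplicative.toAdd hg⟩

theorem theorem1p1 (p n k : ℕ) (hp : p.Prime) (hn : 1 ≤ n) (hn2 : p = 2 → 2 ≤ n) :
    ((p ^ k : ℕ) : ℕ∞) ≤
        realizationMultiplicity.{u, 0} (FreeModuleSemidirect (ZMod p) (CyclicPPow p n) k) ∧
      ∀ (F : Type u) [Field F] (K : IntermediateField F (AlgebraicClosure F)) [IsGalois F K]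
        (φ : Gal(K/F) ≃* CyclicPPow p n),
        (∃ L, SolvesEmbeddingProblem
          (SemidirectProduct.rightHom :
            FreeModuleSemidirect (ZMod p) (CyclicPPow p n) k →* CyclicPPow p n) K φ L) →
        ((p ^ k : ℕ) : ℕ∞) ≤
          Set.encard {L | SolvesEmbeddingProblem
            (SemidirectProduct.rightHom :
              FreeModuleSemidirect (ZMod p) (CyclicPPow p n) k →* CyclicPPow p n) K φ L} := by
  have : Fact p.Prime := ⟨hp⟩
  have : NeZero (p ^ n) := ⟨pow_ne_zero _ hp.ne_zero⟩
  have : Fact (1 < p ^ n) := ⟨one_lt_pow₀ hp.one_lt (Nat.one_le_iff_ne_zero.1 hn)⟩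
  have hG : IsPGroup p (CyclicPPow p n) :=
    IsPGroup.of_card (n := n) ((Nat.card_congr Multiplicative.toAdd).trans (Nat.card_zmod _))
  have hG2 (h2 : p = 2) : ∃ g : CyclicPPow p n, g ^ 2 ≠ 1 :=
    exists_sq_ne_one_cyclicPPow <| Nat.not_dvd_of_pos_of_lt two_pos <|
      calc 2 < p ^ 2 := by norm_num [h2]
        _ ≤ p ^ n := Nat.pow_le_pow_right hp.pos (hn2 h2)
  obtain ⟨hmult, hsol⟩ := theorem1p1_general (k := k) hG hG2
  exact ⟨hmult, fun F _ K _ φ => hsol F K φ⟩
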